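/- Let $N\ge 1$ and let $\Omega\subset\mathbb R^N$ be a bounded open set. Let $a,b,c,d,\alpha,\beta,D_1,D_2,D_3,D_4$ be positive constants, let $0<T_{\max}\le\infty$, and let $(u,v,w,z)$ be a classical solution on $[0,T_{\max})\times\Omega$ of the system $$\begin{aligned} \partial_t u-a\Delta u&=\alpha-(\beta+1)u+u^2v+D_1(w-u),\\ \partial_t v-b\Delta v&=\beta u-u^2v+D_2(z-v),\\ \partial_t w-c\Delta w&=\alpha-(\beta+1)w+w^2z+D_3(u-w),\\ \partial_t z-d\Delta z&=\beta w-w^2z+D_4(v-z), \end{aligned}$$ with $u=v=w=z=0$ on $(0,T_{\max})\times\partial\Omega$ and with nonnegative initial data in $L^\infty(\Omega)$. Here a classical solution has components that are continuous on $(0,T_{\max})\times\overline\Omega$ and of class $C^{1,2}$ (once in $t$, twice in $x$) on $(0,T_{\max})\times\Omega$, are bounded on $(0,t_1]\times\Omega$ for each finite $t_1<T_{\max}$, and converge in $L^1(\Omega)$ to the initial data as $t\to0^+$. Put $A_{12}=\frac{a+b}{2\sqrt{ab}}$, $A_{13}=\frac{a+c}{2\sqrt{ac}}$, $A_{14}=\frac{a+d}{2\sqrt{ad}}$,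 $A_{23}=\frac{b+c}{2\sqrt{bc}}$, $A_{24}=\frac{b+d}{2\sqrt{bd}}$, $A_{34}=\frac{c+d}{2\sqrt{cd}}$, and let $\theta,\sigma,\rho>0$ satisfy $$\theta^2>A_{12}^2,\qquad (\theta^2-A_{12}^2)(\sigma^2-A_{23}^2)>(A_{13}-A_{12}A_{23})^2,\qquad \Lambda V>\Gamma^2,$$ where $$\begin{aligned} \Lambda&=(\theta^2-A_{12}^2)(\sigma^2-A_{23}^2)-(A_{13}-A_{12}A_{23})^2,\\ V&=(\theta^2-A_{12}^2)(\sigma^2\rho^2-A_{24}^2)-(A_{14}-A_{12}A_{24})^2,\\ \Gamma&=(\theta^2-A_{12}^2)(A_{34}\sigma^2-A_{23}A_{24})-(A_{13}-A_{12}A_{23})(A_{14}-A_{12}A_{24}). \end{aligned}$$ Let $n\ge1$ be an integer and let $(\theta_i)_{i\ge0},(\sigma_i)_{i\ge0},(\rho_i)_{i\ge0}$ be positive sequences with $$\frac{\theta_i\theta_{i+2}}{\theta_{i+1}^2}=\theta^2,\qquad \frac{\sigma_i\sigma_{i+2}}{\sigma_{i+1}^2}=\sigma^2,\qquad \frac{\rho_i\rho_{i+2}}{\rho_{i+1}^2}=\rho^2\qquad(0\le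 i\le n).$$ Define $$H_n(u,v,w,z)=\sum_{p=0}^n\sum_{q=0}^p\sum_{r=0}^q\binom np\binom pq\binom qr\,\theta_r\sigma_q\rho_p\,u^rv^{q-r}w^{p-q}z^{n-p},\qquad L_n(t)=\int_\Omega H_n\big(u(t,x),v(t,x),w(t,x),z(t,x)\big)\,dx .$$ Then $L_n$ is well defined and uniformly bounded on $[0,T_{\max})$: the integrand is integrable for every $t\in[0,T_{\max})$, and there is a constant $C$ (depending on the solution, but not on $t$) with $|L_n(t)|\le C$ for all $t\in[0,T_{\max})$. -/

import Mathlib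

open MeasureTheory Filter Topology

/-- The ten positive constants of the four-compartment Brusselator system. -/
structure BrusselatorParams where
  (a b c d α β D₁ D₂ D₃ D₄ : ℝ)
  a_pos : 0 < a
  b_pos : 0 < b
  c_pos : 0 < c
  d_pos : 0 < d
  α_pos : 0 < α
  β_pos : 0 < β
  D₁_pos : 0 < D₁
  D₂_pos : 0 < D₂
  D₃_pos : 0 < D₃
  D₄_pos : 0 < D₄

namespace BrusselatorParams

/-- Reaction term of the `u`-equation. -/
def f (P : BrusselatorParams) (u v w _z : ℝ) : ℝ :=
  P.α - (P.β + 1) * u + u ^ 2 * v + P.D₁ * (w - u)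

/-- Reaction term of the `v`-equation. -/
def g (P : BrusselatorParams) (u v _w z : ℝ) : ℝ :=
  P.β * u - u ^ 2 * v + P.D₂ * (z - v)

/-- Reaction term of the `w`-equation. -/
def h (P : BrusselatorParams) (u _v w z : ℝ) : ℝ :=
  P.α - (P.β + 1) * w + w ^ 2 * z + P.D₃ * (u - w)

/-- Reaction term of the `z`-equation. -/
def k (P : BrusselatorParams) (_u v w z : ℝ) : ℝ :=
  P.β * w - w ^ 2 * z + P.D₄ * (v - z)

end BrusselatorParams

/-- Regularity, boundary condition and initial data of one component `u = u(t, x)` of a classical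
solution on `[0, T) × Ω`, where `0 < T ≤ ∞`. The initial datum is `u 0`; it is a nonnegative
element of `L^∞(Ω)`. -/
structure IsClassicalComponent {N : ℕ} (Ω : Set (EuclideanSpace ℝ (Fin N))) (T : EReal)
    (u : ℝ → EuclideanSpace ℝ (Fin N) → ℝ) : Prop where
  /-- `u` is continuous on `(0, T) × closure Ω`. -/
  continuousOn : ContinuousOn (fun p : ℝ × EuclideanSpace ℝ (Fin N) => u p.1 p.2)
    {p | 0 < p.1 ∧ (p.1 : EReal) < T ∧ p.2 ∈ closure Ω}
  /-- `∂u/∂t` exists in `(0, T) × Ω`. -/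
  differentiableAt_time : ∀ t : ℝ, 0 < t → (t : EReal) < T → ∀ x ∈ Ω,
    DifferentiableAt ℝ (fun s => u s x) t
  /-- `∂u/∂t` is continuous on `(0, T) × Ω`. -/
  continuousOn_time : ContinuousOn
    (fun p : ℝ × EuclideanSpace ℝ (Fin N) => deriv (fun s => u s p.2) p.1)
    {p | 0 < p.1 ∧ (p.1 : EReal) < T ∧ p.2 ∈ Ω}
  /-- `u(t, ·)` is twice continuously differentiable in `Ω`. -/
  contDiffOn_space : ∀ t : ℝ, 0 < t → (t : EReal) < T → ContDiffOn ℝ 2 (u t) Ω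
  /-- The first space derivatives are jointly continuous on `(0, T) × Ω`. -/
  continuousOn_fderiv : ContinuousOn
    (fun p : ℝ × EuclideanSpace ℝ (Fin N) => fderiv ℝ (u p.1) p.2)
    {p | 0 < p.1 ∧ (p.1 : EReal) < T ∧ p.2 ∈ Ω}
  /-- The second space derivatives are jointly continuous on `(0, T) × Ω`. -/
  continuousOn_fderiv_fderiv : ContinuousOn
    (fun p : ℝ × EuclideanSpace ℝ (Fin N) => fderiv ℝ (fderiv ℝ (u p.1)) p.2)
    {p | 0 < p.1 ∧ (p.1 : EReal) < T ∧ p.2 ∈ Ω}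
  /-- Homogeneous Dirichlet boundary condition. -/
  boundary : ∀ t : ℝ, 0 < t → (t : EReal) < T → ∀ x ∈ frontier Ω, u t x = 0
  /-- `u` is bounded on `(0, t₁] × Ω` for every finite `t₁ < T`; the bound may blow up as
  `t₁` tends to `T`. -/
  locally_bounded : ∀ t₁ : ℝ, (t₁ : EReal) < T →
    ∃ M : ℝ, ∀ t : ℝ, 0 < t → t ≤ t₁ → ∀ x ∈ Ω, |u t x| ≤ M
  /-- The initial datum lies in `L^∞(Ω)`. -/
  initial_memLp : MemLp (u 0) ⊤ (volume.restrict Ω)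
  /-- The initial datum is nonnegative. -/
  initial_nonneg : ∀ᵐ x ∂(volume.restrict Ω), 0 ≤ u 0 x
  /-- The initial datum is attained in `L¹(Ω)` (in view of `locally_bounded`, this is the same as
  in `L^p(Ω)` for all finite `p`; it follows from continuity of `u` on `[0, T) × closure Ω`,
  or from pointwise convergence in `Ω`). -/
  initial_tendsto :
    Tendsto (fun t : ℝ => eLpNorm (fun x => u t x - u 0 x) 1 (volume.restrict Ω)) (𝓝[>] 0) (𝓝 0)

/-- `(u, v, w, z)` is a classical solution on `[0, T) × Ω` of the four-compartment Brusselator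
system with homogeneous Dirichlet boundary conditions and nonnegative bounded initial data. -/
structure IsBrusselatorSolution {N : ℕ} (P : BrusselatorParams)
    (Ω : Set (EuclideanSpace ℝ (Fin N))) (T : EReal)
    (u v w z : ℝ → EuclideanSpace ℝ (Fin N) → ℝ) : Prop where
  comp_u : IsClassicalComponent Ω T u
  comp_v : IsClassicalComponent Ω T v
  comp_w : IsClassicalComponent Ω T w
  comp_z : IsClassicalComponent Ω T z
  eq_u : ∀ t : ℝ, 0 < t → (t : EReal) < T → ∀ x ∈ Ω,
    deriv (fun s => u s x) t - P.a * Laplacian.laplacian (u t) x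
      = P.f (u t x) (v t x) (w t x) (z t x)
  eq_v : ∀ t : ℝ, 0 < t → (t : EReal) < T → ∀ x ∈ Ω,
    deriv (fun s => v s x) t - P.b * Laplacian.laplacian (v t) x
      = P.g (u t x) (v t x) (w t x) (z t x)
  eq_w : ∀ t : ℝ, 0 < t → (t : EReal) < T → ∀ x ∈ Ω,
    deriv (fun s => w s x) t - P.c * Laplacian.laplacian (w t) x
      = P.h (u t x) (v t x) (w t x) (z t x)
  eq_z : ∀ t : ℝ, 0 < t → (t : EReal) < T → ∀ x ∈ Ω,
    deriv (fun s => z s x) t - P.d * Laplacian.laplacian (z t) x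
      = P.k (u t x) (v t x) (w t x) (z t x)

/-- The ratio `(x + y) / (2 √(x y))` of the arithmetic and the geometric mean of two diffusion
coefficients. -/
noncomputable def meanRatio (x y : ℝ) : ℝ := (x + y) / (2 * Real.sqrt (x * y))

namespace BrusselatorParams

noncomputable def A₁₂ (P : BrusselatorParams) : ℝ := meanRatio P.a P.b

noncomputable def A₁₃ (P : BrusselatorParams) : ℝ := meanRatio P.a P.c

noncomputable def A₁₄ (P : BrusselatorParams) : ℝ := meanRatio P.a P.d

noncomputable def A₂₃ (P : BrusselatorParams) : ℝ := meanRatio P.b P.c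

noncomputable def A₂₄ (P : BrusselatorParams) : ℝ := meanRatio P.b P.d

noncomputable def A₃₄ (P : BrusselatorParams) : ℝ := meanRatio P.c P.d

noncomputable def Λ (P : BrusselatorParams) (θ σ : ℝ) : ℝ :=
  (θ ^ 2 - P.A₁₂ ^ 2) * (σ ^ 2 - P.A₂₃ ^ 2) - (P.A₁₃ - P.A₁₂ * P.A₂₃) ^ 2

noncomputable def V (P : BrusselatorParams) (θ σ ρ : ℝ) : ℝ :=
  (θ ^ 2 - P.A₁₂ ^ 2) * (σ ^ 2 * ρ ^ 2 - P.A₂₄ ^ 2) - (P.A₁₄ - P.A₁₂ * P.A₂₄) ^ 2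

noncomputable def Γ (P : BrusselatorParams) (θ σ : ℝ) : ℝ :=
  (θ ^ 2 - P.A₁₂ ^ 2) * (P.A₃₄ * σ ^ 2 - P.A₂₃ * P.A₂₄)
    - (P.A₁₃ - P.A₁₂ * P.A₂₃) * (P.A₁₄ - P.A₁₂ * P.A₂₄)

/-- The three positivity conditions on the positive constants `θ, σ, ρ`. -/
structure Admissible (P : BrusselatorParams) (θ σ ρ : ℝ) : Prop where
  θ_pos : 0 < θ
  σ_pos : 0 < σ
  ρ_pos : 0 < ρ
  cond₁ : P.A₁₂ ^ 2 < θ ^ 2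
  cond₂ : (P.A₁₃ - P.A₁₂ * P.A₂₃) ^ 2 < (θ ^ 2 - P.A₁₂ ^ 2) * (σ ^ 2 - P.A₂₃ ^ 2)
  cond₃ : P.Γ θ σ ^ 2 < P.Λ θ σ * P.V θ σ ρ

end BrusselatorParams

/-- A positive sequence `s` with `s_i s_{i+2} / s_{i+1}^2 = κ ^ 2` for `0 ≤ i ≤ n`. -/
structure IsRatioSequence (n : ℕ) (κ : ℝ) (s : ℕ → ℝ) : Prop where
  pos : ∀ i, 0 < s i
  ratio : ∀ i ≤ n, s i * s (i + 2) / s (i + 1) ^ 2 = κ ^ 2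

/-- The homogeneous polynomial `H_n` of degree `n` with coefficients built from the sequences
`θ_r`, `σ_q`, `ρ_p`. -/
def lyapunovPoly (n : ℕ) (θ σ ρ : ℕ → ℝ) (u v w z : ℝ) : ℝ :=
  ∑ p ∈ Finset.range (n + 1), ∑ q ∈ Finset.range (p + 1), ∑ r ∈ Finset.range (q + 1),
    (n.choose p : ℝ) * (p.choose q : ℝ) * (q.choose r : ℝ) * (θ r * σ q * ρ p)
      * (u ^ r * v ^ (q - r) * w ^ (p - q) * z ^ (n - p))

/-- The functional `L_n(t) = ∫_Ω H_n(u(t,x), v(t,x), w(t,x), z(t,x)) dx`. -/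
noncomputable def lyapunovFunctional {N : ℕ} (Ω : Set (EuclideanSpace ℝ (Fin N))) (n : ℕ)
    (θ σ ρ : ℕ → ℝ) (u v w z : ℝ → EuclideanSpace ℝ (Fin N) → ℝ) (t : ℝ) : ℝ :=
  ∫ x in Ω, lyapunovPoly n θ σ ρ (u t x) (v t x) (w t x) (z t x)

/-! The coefficients of `H_n` are positive and all its terms have degree `n`, so `|H_n|` is at most
a constant times the `n`-th power of any common bound of the four components
(`abs_lyapunovPoly_le`). It therefore suffices to bound `v`, `z` and all moments of `u`, `w`
uniformly in time.

Nonnegativity (`IsBrusselatorSolution.nonneg`): each reaction term is quasi-positive up to the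
negative parts of the other components, so Grönwall applies to the cubes of the negative parts.

Bounds of `v` and `z` (`IsBrusselatorSolution.exists_v_z_le`): once `v ≥ 1`, completing the square
gives `β u - u² v ≤ β² / 4`. Hence `max v z + L ‖x‖²` with `L` large has no high interior maximum
after the starting time.

Moments of `u` and `w` (`exists_integral_excess_pow_le`): with `U = (u - 1)₊` and `m = k + 5`, both
first partial derivatives of the density `lyap` have leading term `m U^(m-1)`. The cubic terms
cancel in the sum of the `u`- and `v`-equations, which leaves the damping `-m U^m`. Large `A` and
`B` make the diffusion form nonnegative for any two diffusion coefficients, and give the remaining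
top-order cubic terms a favourable sign. Weighting the compartments by `1 / D₁` and `1 / D₃` makes
the exchange terms nonpositive. The result is `y' ≤ -κ y + E`, hence a bound independent of the time
horizon.

Neither regularity of the boundary nor control of derivatives near it is available. Every density
used therefore vanishes for small values of its first argument: by the Dirichlet condition it has
compact support in `Ω`, and integration by parts has no boundary term. -/

/-! ### Line derivatives and the Laplacian of `C²` functions. -/

section Slices

variable {E : Type*} [NormedAddCommGroup E] [NormedSpace ℝ E] {Ω : Set E} {f : E → ℝ} {x : E}

lemma hasLineDerivAt_of_contDiffOn_two (hΩ : IsOpen Ω) (hf : ContDiffOn ℝ 2 f Ω) (hx : x ∈ Ω)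
    (e : E) : HasLineDerivAt ℝ f (fderiv ℝ f x e) x e :=
  (((hf.contDiffAt (hΩ.mem_nhds hx)).differentiableAt (by norm_num)).hasFDerivAt).hasLineDerivAt e

lemma contDiffOn_fderiv_of_contDiffOn_two (hΩ : IsOpen Ω) (hf : ContDiffOn ℝ 2 f Ω) :
    ContDiffOn ℝ 1 (fderiv ℝ f) Ω :=
  hf.fderiv_of_isOpen hΩ (by norm_num)

lemma hasLineDerivAt_fderiv_of_contDiffOn_two (hΩ : IsOpen Ω) (hf : ContDiffOn ℝ 2 f Ω)
    (hx : x ∈ Ω) (e : E) :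
    HasLineDerivAt ℝ (fun y => fderiv ℝ f y e) (fderiv ℝ (fderiv ℝ f) x e e) x e := by
  have h1 : HasFDerivAt (fderiv ℝ f) (fderiv ℝ (fderiv ℝ f) x) x :=
    (((contDiffOn_fderiv_of_contDiffOn_two hΩ hf).contDiffAt (hΩ.mem_nhds hx)).differentiableAt
      (by norm_num)).hasFDerivAt
  have h2 := h1.clm_apply (hasFDerivAt_const e x)
  simpa using h2.hasLineDerivAt e

lemma continuousOn_fderiv_apply_of_contDiffOn_two (hΩ : IsOpen Ω) (hf : ContDiffOn ℝ 2 f Ω)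
    (e : E) : ContinuousOn (fun y => fderiv ℝ f y e) Ω :=
  (contDiffOn_fderiv_of_contDiffOn_two hΩ hf).continuousOn.clm_apply continuousOn_const

lemma continuousOn_fderiv_fderiv_apply_of_contDiffOn_two (hΩ : IsOpen Ω)
    (hf : ContDiffOn ℝ 2 f Ω) (e : E) :
    ContinuousOn (fun y => fderiv ℝ (fderiv ℝ f) y e e) Ω :=
  (((contDiffOn_fderiv_of_contDiffOn_two hΩ hf).continuousOn_fderiv_of_isOpen hΩ
    le_rfl).clm_apply continuousOn_const).clm_apply continuousOn_const

end Slices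

lemma laplacian_eq_sum_fderiv_fderiv {N : ℕ} (f : EuclideanSpace ℝ (Fin N) → ℝ)
    (x : EuclideanSpace ℝ (Fin N)) :
    Laplacian.laplacian f x = ∑ i, fderiv ℝ (fderiv ℝ f) x (EuclideanSpace.basisFun (Fin N) ℝ i)
      (EuclideanSpace.basisFun (Fin N) ℝ i) := by
  have := congrFun (InnerProductSpace.laplacian_eq_iteratedFDeriv_orthonormalBasis f
    (EuclideanSpace.basisFun (Fin N) ℝ)) x
  simpa [iteratedFDeriv_two_apply] using this

/-! ### Integration by parts without boundary terms. -/

section CompactSupport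

variable {E : Type*} [NormedAddCommGroup E] [MeasurableSpace E] [BorelSpace E]
  {Ω K : Set E} {f f' : E → ℝ} {μ : Measure E}

lemma integrableOn_of_continuousOn_of_zero_off_compact [IsFiniteMeasureOnCompacts μ]
    (hΩ : IsOpen Ω) (hK : IsCompact K) (hKΩ : K ⊆ Ω) (hf : ContinuousOn f Ω) (h0 : ∀ x ∈ Ω, x ∉ K → f x = 0) :
    IntegrableOn f Ω μ := by
  rw [← integrable_indicator_iff hΩ.measurableSet]
  rw [← integrableOn_iff_integrable_of_support_subset (s := K)]
  · refine ((hf.mono hKΩ).integrableOn_compact hK).congr_fun ?_ hK.measurableSet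
    intro x hx
    simp [Set.indicator_of_mem (hKΩ hx)]
  · intro x hx
    by_contra hxK
    apply hx
    by_cases hxΩ : x ∈ Ω
    · rw [Set.indicator_of_mem hxΩ, h0 x hxΩ hxK]
    · rw [Set.indicator_of_notMem hxΩ]

/-- Extended by zero outside `Ω`, `f` is line-differentiable everywhere: points outside `Ω` lie in
the open complement of `K`, where the extension vanishes. -/
lemma setIntegral_lineDeriv_eq_zero [NormedSpace ℝ E] [FiniteDimensional ℝ E]
    [μ.IsAddHaarMeasure]
    (hΩ : IsOpen Ω) (hK : IsCompact K) (hKΩ : K ⊆ Ω)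
    (hf : ContinuousOn f Ω) (hf' : ContinuousOn f' Ω)
    (h0 : ∀ x ∈ Ω, x ∉ K → f x = 0) (h0' : ∀ x ∈ Ω, x ∉ K → f' x = 0) (e : E)
    (hd : ∀ x ∈ Ω, HasLineDerivAt ℝ f (f' x) x e) :
    ∫ x in Ω, f' x ∂μ = 0 := by
  have i1 := (integrable_indicator_iff hΩ.measurableSet).2
    (integrableOn_of_continuousOn_of_zero_off_compact (μ := μ) hΩ hK hKΩ hf h0)
  have i2 := (integrable_indicator_iff hΩ.measurableSet).2
    (integrableOn_of_continuousOn_of_zero_off_compact (μ := μ) hΩ hK hKΩ hf' h0')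
  have hzero : ∀ x ∉ K, Ω.indicator f x = 0 := by
    intro x hxK
    by_cases hxΩ : x ∈ Ω
    · rw [Set.indicator_of_mem hxΩ, h0 x hxΩ hxK]
    · rw [Set.indicator_of_notMem hxΩ]
  have key : ∀ x, HasLineDerivAt ℝ (Ω.indicator f) (Ω.indicator f' x) x e := by
    intro x
    by_cases hxΩ : x ∈ Ω
    · rw [Set.indicator_of_mem hxΩ]
      refine (hd x hxΩ).congr_of_eventuallyEq ?_
      filter_upwards [hΩ.mem_nhds hxΩ] with y hy
      rw [Set.indicator_of_mem hy]
    · rw [Set.indicator_of_notMem hxΩ]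
      have hxK : x ∉ K := fun h => hxΩ (hKΩ h)
      have hc : HasLineDerivAt ℝ (fun _ : E => (0 : ℝ)) 0 x e := by
        simpa using (hasFDerivAt_const (0 : ℝ) x).hasLineDerivAt e
      refine hc.congr_of_eventuallyEq ?_
      filter_upwards [hK.isClosed.isOpen_compl.mem_nhds hxK] with y hy
      exact hzero y hy
  have hone : ∀ x : E, HasLineDerivAt ℝ (fun _ : E => (1 : ℝ)) ((fun _ => (0 : ℝ)) x) x e := by
    intro x
    simpa using (hasFDerivAt_const (1 : ℝ) x).hasLineDerivAt e
  -- Integration by parts against the constant `1`, whose derivative is `0`.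
  have := integral_bilinear_hasLineDerivAt_right_eq_neg_left_of_integrable (μ := μ)
    (f := Ω.indicator f) (f' := Ω.indicator f') (g := fun _ => (1 : ℝ)) (g' := fun _ => (0 : ℝ))
    (v := e) (B := ContinuousLinearMap.mul ℝ ℝ) (by simpa using i2) (by simp) (by simpa using i1)
    (fun x _ => key x) (fun x _ => hone x)
  rw [← integral_indicator hΩ.measurableSet]
  simpa using this

end CompactSupport

/-! ### Truncated densities and the sign of the diffusion terms. -/

/-- `G` is a function of two real variables of class `C²` with the displayed partial derivatives,
which vanishes together with them in the strip `|p| < κ`. -/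
structure IsDensity (κ : ℝ) (G Gp Gq Gpp Gpq Gqq : ℝ → ℝ → ℝ) : Prop where
  chain : ∀ (x y : ℝ → ℝ) (x' y' s : ℝ), HasDerivAt x x' s → HasDerivAt y y' s →
    HasDerivAt (fun r => G (x r) (y r)) (Gp (x s) (y s) * x' + Gq (x s) (y s) * y') s
  chain_p : ∀ (x y : ℝ → ℝ) (x' y' s : ℝ), HasDerivAt x x' s → HasDerivAt y y' s →
    HasDerivAt (fun r => Gp (x r) (y r)) (Gpp (x s) (y s) * x' + Gpq (x s) (y s) * y') s
  chain_q : ∀ (x y : ℝ → ℝ) (x' y' s : ℝ), HasDerivAt x x' s → HasDerivAt y y' s →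
    HasDerivAt (fun r => Gq (x r) (y r)) (Gpq (x s) (y s) * x' + Gqq (x s) (y s) * y') s
  cont : Continuous (fun y : ℝ × ℝ => G y.1 y.2)
  cont_p : Continuous (fun y : ℝ × ℝ => Gp y.1 y.2)
  cont_q : Continuous (fun y : ℝ × ℝ => Gq y.1 y.2)
  cont_pp : Continuous (fun y : ℝ × ℝ => Gpp y.1 y.2)
  cont_pq : Continuous (fun y : ℝ × ℝ => Gpq y.1 y.2)
  cont_qq : Continuous (fun y : ℝ × ℝ => Gqq y.1 y.2)
  zero : ∀ p q, |p| < κ → G p q = 0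
  zero_p : ∀ p q, |p| < κ → Gp p q = 0
  zero_q : ∀ p q, |p| < κ → Gq p q = 0
  zero_pp : ∀ p q, |p| < κ → Gpp p q = 0
  zero_pq : ∀ p q, |p| < κ → Gpq p q = 0
  zero_qq : ∀ p q, |p| < κ → Gqq p q = 0

section Diffusion

variable {N : ℕ} {Ω K : Set (EuclideanSpace ℝ (Fin N))} {u v : EuclideanSpace ℝ (Fin N) → ℝ}
  {κ a b : ℝ} {G Gp Gq Gpp Gpq Gqq : ℝ → ℝ → ℝ}

lemma continuousOn_laplacian_of_contDiffOn_two (hΩ : IsOpen Ω) (hu : ContDiffOn ℝ 2 u Ω) :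
    ContinuousOn (Laplacian.laplacian u) Ω := by
  have h : ContinuousOn (fun x => ∑ i, fderiv ℝ (fderiv ℝ u) x
      (EuclideanSpace.basisFun (Fin N) ℝ i) (EuclideanSpace.basisFun (Fin N) ℝ i)) Ω :=
    continuousOn_finsetSum _ fun i _ => continuousOn_fderiv_fderiv_apply_of_contDiffOn_two hΩ hu _
  exact h.congr fun x _ => laplacian_eq_sum_fderiv_fderiv u x

/-- The diffusion terms are the divergence of `a Gp ∇u + b Gq ∇v` minus the quadratic form in the
gradients. The divergence integrates to zero and the form is nonnegative. Only `u` has to be small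
off `K`. -/
lemma setIntegral_diffusion_nonpos (hG : IsDensity κ G Gp Gq Gpp Gpq Gqq)
    (hΩ : IsOpen Ω) (hK : IsCompact K) (hKΩ : K ⊆ Ω)
    (hu : ContDiffOn ℝ 2 u Ω) (hv : ContDiffOn ℝ 2 v Ω) (hsmall : ∀ x ∈ Ω, x ∉ K → |u x| < κ)
    (hform : ∀ x ∈ Ω, ∀ ξ η : ℝ, 0 ≤ a * Gpp (u x) (v x) * ξ ^ 2
      + (a + b) * Gpq (u x) (v x) * (ξ * η) + b * Gqq (u x) (v x) * η ^ 2) :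
    IntegrableOn (fun x => a * Gp (u x) (v x) * Laplacian.laplacian u x
      + b * Gq (u x) (v x) * Laplacian.laplacian v x) Ω ∧
    ∫ x in Ω, (a * Gp (u x) (v x) * Laplacian.laplacian u x
      + b * Gq (u x) (v x) * Laplacian.laplacian v x) ≤ 0 := by
  have cuv : ContinuousOn (fun x => (u x, v x)) Ω := hu.continuousOn.prodMk hv.continuousOn
  have cp := hG.cont_p.comp_continuousOn cuv
  have cq := hG.cont_q.comp_continuousOn cuv
  have cpp := hG.cont_pp.comp_continuousOn cuv
  have cpq := hG.cont_pq.comp_continuousOn cuv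
  have cqq := hG.cont_qq.comp_continuousOn cuv
  simp only [Function.comp_def] at cp cq cpp cpq cqq
  set e : Fin N → EuclideanSpace ℝ (Fin N) := fun i => EuclideanSpace.basisFun (Fin N) ℝ i
  have hint : IntegrableOn (fun x => a * Gp (u x) (v x) * Laplacian.laplacian u x
      + b * Gq (u x) (v x) * Laplacian.laplacian v x) Ω := by
    refine integrableOn_of_continuousOn_of_zero_off_compact hΩ hK hKΩ ?_ ?_
    · exact ((continuousOn_const.mul cp).mul (continuousOn_laplacian_of_contDiffOn_two hΩ hu)).add
        ((continuousOn_const.mul cq).mul (continuousOn_laplacian_of_contDiffOn_two hΩ hv))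
    · intro x hx hxK
      simp [hG.zero_p _ (v x) (hsmall x hx hxK), hG.zero_q _ (v x) (hsmall x hx hxK)]
  refine ⟨hint, ?_⟩
  -- `D i` is the `i`-th directional derivative of `a Gp ∂ᵢu + b Gq ∂ᵢv`, expanded by the chain
  -- rule.
  set D : Fin N → EuclideanSpace ℝ (Fin N) → ℝ := fun i x =>
    a * ((Gpp (u x) (v x) * fderiv ℝ u x (e i) + Gpq (u x) (v x) * fderiv ℝ v x (e i))
        * fderiv ℝ u x (e i) + Gp (u x) (v x) * fderiv ℝ (fderiv ℝ u) x (e i) (e i))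
    + b * ((Gpq (u x) (v x) * fderiv ℝ u x (e i) + Gqq (u x) (v x) * fderiv ℝ v x (e i))
        * fderiv ℝ v x (e i) + Gq (u x) (v x) * fderiv ℝ (fderiv ℝ v) x (e i) (e i)) with hD
  have cD : ∀ i, ContinuousOn (D i) Ω := by
    intro i
    have c1 := continuousOn_fderiv_apply_of_contDiffOn_two hΩ hu (e i)
    have c2 := continuousOn_fderiv_apply_of_contDiffOn_two hΩ hv (e i)
    have c3 := continuousOn_fderiv_fderiv_apply_of_contDiffOn_two hΩ hu (e i)
    have c4 := continuousOn_fderiv_fderiv_apply_of_contDiffOn_two hΩ hv (e i)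
    exact (continuousOn_const.mul ((((cpp.mul c1).add (cpq.mul c2)).mul c1).add (cp.mul c3))).add
      (continuousOn_const.mul ((((cpq.mul c1).add (cqq.mul c2)).mul c2).add (cq.mul c4)))
  have zD : ∀ i, ∀ x ∈ Ω, x ∉ K → D i x = 0 := by
    intro i x hx hxK
    have h := hsmall x hx hxK
    simp [hD, hG.zero_p _ (v x) h, hG.zero_q _ (v x) h, hG.zero_pp _ (v x) h,
      hG.zero_pq _ (v x) h, hG.zero_qq _ (v x) h]
  have iD : ∀ i, IntegrableOn (D i) Ω := fun i =>
    integrableOn_of_continuousOn_of_zero_off_compact hΩ hK hKΩ (cD i) (zD i)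
  have intD : ∀ i, ∫ x in Ω, D i x = 0 := by
    intro i
    refine setIntegral_lineDeriv_eq_zero (f := fun x => a * (Gp (u x) (v x) * fderiv ℝ u x (e i))
      + b * (Gq (u x) (v x) * fderiv ℝ v x (e i))) hΩ hK hKΩ ?_ (cD i) ?_ (zD i) (e i) ?_
    · exact (continuousOn_const.mul
          (cp.mul (continuousOn_fderiv_apply_of_contDiffOn_two hΩ hu (e i)))).add
        (continuousOn_const.mul
          (cq.mul (continuousOn_fderiv_apply_of_contDiffOn_two hΩ hv (e i))))
    · intro x hx hxK
      simp [hG.zero_p _ (v x) (hsmall x hx hxK), hG.zero_q _ (v x) (hsmall x hx hxK)]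
    · intro x hx
      have d1 : HasDerivAt _ _ _ := hasLineDerivAt_of_contDiffOn_two hΩ hu hx (e i)
      have d2 : HasDerivAt _ _ _ := hasLineDerivAt_of_contDiffOn_two hΩ hv hx (e i)
      have d3 : HasDerivAt _ _ _ := hasLineDerivAt_fderiv_of_contDiffOn_two hΩ hu hx (e i)
      have d4 : HasDerivAt _ _ _ := hasLineDerivAt_fderiv_of_contDiffOn_two hΩ hv hx (e i)
      have := (((hG.chain_p _ _ _ _ _ d1 d2).mul d3).const_mul a).fun_add
        (((hG.chain_q _ _ _ _ _ d1 d2).mul d4).const_mul b)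
      unfold HasLineDerivAt
      simpa [hD] using this
  have hsum : ∫ x in Ω, ∑ i, D i x = 0 := by
    rw [integral_finsetSum _ fun i _ => iD i]
    simp [intD]
  rw [← hsum]
  refine setIntegral_mono_on hint (integrable_finsetSum _ fun i _ => iD i) hΩ.measurableSet ?_
  intro x hx
  rw [laplacian_eq_sum_fderiv_fderiv, laplacian_eq_sum_fderiv_fderiv, Finset.mul_sum,
    Finset.mul_sum, ← Finset.sum_add_distrib]
  refine Finset.sum_le_sum fun i _ => ?_
  have := hform x hx (fderiv ℝ u x (e i)) (fderiv ℝ v x (e i))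
  simp only [hD]
  linarith

end Diffusion

/-! ### Evolution of `∫ G(u, v)` along classical solutions. -/

lemma coe_lt_of_le_of_coe_lt {s t : ℝ} {T : EReal} (hst : s ≤ t) (ht : (t : EReal) < T) :
    (s : EReal) < T :=
  lt_of_le_of_lt (EReal.coe_le_coe_iff.2 hst) ht

lemma exists_gt_coe_lt {t : ℝ} {T : EReal} (ht : (t : EReal) < T) :
    ∃ s : ℝ, t < s ∧ (s : EReal) < T := by
  obtain ⟨s, h1, h2⟩ := EReal.lt_iff_exists_real_btwn.1 ht
  exact ⟨s, EReal.coe_lt_coe_iff.1 h1, h2⟩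

namespace IsClassicalComponent

variable {N : ℕ} {Ω : Set (EuclideanSpace ℝ (Fin N))} {T : EReal}
  {u v : ℝ → EuclideanSpace ℝ (Fin N) → ℝ} {t t₁ t₂ κ a b : ℝ} {G Gp Gq Gpp Gpq Gqq : ℝ → ℝ → ℝ}

/-- The set `|u| ≥ κ` in `[t₁, t₂] × closure Ω` is compact and misses the boundary; its projection
to space serves for all these times at once. -/
lemma exists_compact_abs_lt (hu : IsClassicalComponent Ω T u) (hΩ : IsOpen Ω)
    (hb : Bornology.IsBounded Ω) (ht₁ : 0 < t₁) (ht₂ : (t₂ : EReal) < T) (hκ : 0 < κ) :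
    ∃ K ⊆ Ω, IsCompact K ∧ ∀ t ∈ Set.Icc t₁ t₂, ∀ x ∈ Ω, x ∉ K → |u t x| < κ := by
  have hcl : IsCompact (closure Ω) := hb.isCompact_closure
  have hsub : ∀ p ∈ Set.Icc t₁ t₂ ×ˢ closure Ω, 0 < p.1 ∧ (p.1 : EReal) < T ∧ p.2 ∈ closure Ω :=
    fun p hp => ⟨ht₁.trans_le hp.1.1, coe_lt_of_le_of_coe_lt hp.1.2 ht₂, hp.2⟩
  have hc : ContinuousOn (fun p : ℝ × EuclideanSpace ℝ (Fin N) => |u p.1 p.2|)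
      (Set.Icc t₁ t₂ ×ˢ closure Ω) := (hu.continuousOn.mono hsub).abs
  have hS : IsCompact ((Set.Icc t₁ t₂ ×ˢ closure Ω) ∩
      (fun p : ℝ × EuclideanSpace ℝ (Fin N) => |u p.1 p.2|) ⁻¹' Set.Ici κ) :=
    (isCompact_Icc.prod hcl).of_isClosed_subset
      (hc.preimage_isClosed_of_isClosed (isClosed_Icc.prod isClosed_closure) isClosed_Ici)
      Set.inter_subset_left
  refine ⟨_, ?_, hS.image continuous_snd, ?_⟩
  · rintro x ⟨⟨s, y⟩, ⟨hp, hκ'⟩, rfl⟩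
    by_contra hx
    have hfr : y ∈ frontier Ω := ⟨hp.2, by rwa [hΩ.interior_eq]⟩
    have h0 := hu.boundary s (hsub _ hp).1 (hsub _ hp).2.1 y hfr
    simp only [Set.mem_preimage, Set.mem_Ici, h0, abs_zero] at hκ'
    linarith
  · intro t ht x hx hxK
    by_contra hlt
    exact hxK ⟨(t, x), ⟨⟨ht, subset_closure hx⟩, not_lt.1 hlt⟩, rfl⟩

lemma continuousOn_slice (hu : IsClassicalComponent Ω T u) (ht : 0 < t) (hT : (t : EReal) < T) :
    ContinuousOn (u t) Ω :=
  (hu.contDiffOn_space t ht hT).continuousOn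

lemma continuousOn_time_slice (hu : IsClassicalComponent Ω T u) (ht : 0 < t)
    (hT : (t : EReal) < T) : ContinuousOn (fun x => deriv (fun s => u s x) t) Ω :=
  hu.continuousOn_time.comp (continuousOn_const.prodMk continuousOn_id) fun _ hx => ⟨ht, hT, hx⟩

lemma integrableOn_density (hu : IsClassicalComponent Ω T u) (hv : IsClassicalComponent Ω T v)
    (hG : IsDensity κ G Gp Gq Gpp Gpq Gqq) (hκ : 0 < κ) (hΩ : IsOpen Ω)
    (hb : Bornology.IsBounded Ω) (ht : 0 < t) (hT : (t : EReal) < T) :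
    IntegrableOn (fun x => G (u t x) (v t x)) Ω := by
  obtain ⟨K, hKΩ, hK, hsm⟩ := hu.exists_compact_abs_lt hΩ hb ht hT hκ
  exact integrableOn_of_continuousOn_of_zero_off_compact hΩ hK hKΩ
    (hG.cont.comp_continuousOn
      ((hu.continuousOn_slice ht hT).prodMk (hv.continuousOn_slice ht hT)))
    fun x hx hxK => hG.zero _ _ (hsm t ⟨le_rfl, le_rfl⟩ x hx hxK)

/-- Domination is by a constant: the time derivative of the integrand is bounded on the compact
`[t/2, t₂] × K` and vanishes off `K`. -/
lemma hasDerivAt_integral_density (hu : IsClassicalComponent Ω T u)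
    (hv : IsClassicalComponent Ω T v) (hG : IsDensity κ G Gp Gq Gpp Gpq Gqq) (hκ : 0 < κ)
    (hΩ : IsOpen Ω) (hb : Bornology.IsBounded Ω) (ht : 0 < t) (hT : (t : EReal) < T) :
    IntegrableOn (fun x => Gp (u t x) (v t x) * deriv (fun s => u s x) t
      + Gq (u t x) (v t x) * deriv (fun s => v s x) t) Ω ∧
    HasDerivAt (fun s => ∫ x in Ω, G (u s x) (v s x))
      (∫ x in Ω, (Gp (u t x) (v t x) * deriv (fun s => u s x) t
        + Gq (u t x) (v t x) * deriv (fun s => v s x) t)) t := by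
  obtain ⟨t₂, htt₂, ht₂⟩ := exists_gt_coe_lt hT
  have ht₁ : 0 < t / 2 := by positivity
  obtain ⟨K, hKΩ, hK, hsm⟩ := hu.exists_compact_abs_lt hΩ hb ht₁ ht₂ hκ
  have hIcc : Set.Icc (t / 2) t₂ ∈ 𝓝 t := Icc_mem_nhds (by linarith) htt₂
  have hsub : ∀ p ∈ Set.Icc (t / 2) t₂ ×ˢ K, 0 < p.1 ∧ (p.1 : EReal) < T ∧ p.2 ∈ Ω :=
    fun p hp => ⟨ht₁.trans_le hp.1.1, coe_lt_of_le_of_coe_lt hp.1.2 ht₂, hKΩ hp.2⟩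
  have hsub' : ∀ p ∈ Set.Icc (t / 2) t₂ ×ˢ K, 0 < p.1 ∧ (p.1 : EReal) < T ∧ p.2 ∈ closure Ω :=
    fun p hp => ⟨(hsub p hp).1, (hsub p hp).2.1, subset_closure (hsub p hp).2.2⟩
  have hcuv := (hu.continuousOn.mono hsub').prodMk (hv.continuousOn.mono hsub')
  have hcont : ContinuousOn (fun p : ℝ × EuclideanSpace ℝ (Fin N) =>
      Gp (u p.1 p.2) (v p.1 p.2) * deriv (fun s => u s p.2) p.1
      + Gq (u p.1 p.2) (v p.1 p.2) * deriv (fun s => v s p.2) p.1)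
      (Set.Icc (t / 2) t₂ ×ˢ K) :=
    ((hG.cont_p.comp_continuousOn hcuv).mul (hu.continuousOn_time.mono hsub)).add
      ((hG.cont_q.comp_continuousOn hcuv).mul (hv.continuousOn_time.mono hsub))
  obtain ⟨B, hB⟩ := (isCompact_Icc.prod hK).exists_bound_of_continuousOn hcont
  have hfin : volume Ω < ⊤ := hb.measure_lt_top
  have hslice : ContinuousOn (fun x => (u t x, v t x)) Ω :=
    (hu.continuousOn_slice ht hT).prodMk (hv.continuousOn_slice ht hT)
  refine hasDerivAt_integral_of_dominated_loc_of_deriv_le (bound := fun _ => max B 0)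
    (F := fun s x => G (u s x) (v s x)) (F' := fun s x =>
      Gp (u s x) (v s x) * deriv (fun r => u r x) s + Gq (u s x) (v s x) * deriv (fun r => v r x) s)
    hIcc ?_ ?_ ?_ ?_ ?_ ?_
  · filter_upwards [hIcc] with s hs
    exact (hu.integrableOn_density hv hG hκ hΩ hb (ht₁.trans_le hs.1)
      (coe_lt_of_le_of_coe_lt hs.2 ht₂)).aestronglyMeasurable
  · exact hu.integrableOn_density hv hG hκ hΩ hb ht hT
  · exact (((hG.cont_p.comp_continuousOn hslice).mul (hu.continuousOn_time_slice ht hT)).add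
      ((hG.cont_q.comp_continuousOn hslice).mul
        (hv.continuousOn_time_slice ht hT))).aestronglyMeasurable hΩ.measurableSet
  · refine (ae_restrict_mem hΩ.measurableSet).mono fun x hx s hs => ?_
    by_cases hxK : x ∈ K
    · exact (hB (s, x) ⟨hs, hxK⟩).trans (le_max_left _ _)
    · have h := hsm s hs x hx hxK
      simp [hG.zero_p _ (v s x) h, hG.zero_q _ (v s x) h]
  · exact integrableOn_const hfin.ne
  · refine (ae_restrict_mem hΩ.measurableSet).mono fun x hx s hs => ?_
    have hs0 := ht₁.trans_le hs.1
    have hsT := coe_lt_of_le_of_coe_lt hs.2 ht₂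
    exact hG.chain _ _ _ _ _ (hu.differentiableAt_time s hs0 hsT x hx).hasDerivAt
      (hv.differentiableAt_time s hs0 hsT x hx).hasDerivAt

/-- The energy inequality: only the reaction terms contribute to the growth of `∫ G(u, v)`. -/
lemma exists_hasDerivAt_integral_density_le (hu : IsClassicalComponent Ω T u)
    (hv : IsClassicalComponent Ω T v) (hG : IsDensity κ G Gp Gq Gpp Gpq Gqq) (hκ : 0 < κ)
    (hΩ : IsOpen Ω) (hb : Bornology.IsBounded Ω) (ht : 0 < t) (hT : (t : EReal) < T)
    {F₁ F₂ : EuclideanSpace ℝ (Fin N) → ℝ}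
    (h₁ : ∀ x ∈ Ω, deriv (fun s => u s x) t - a * Laplacian.laplacian (u t) x = F₁ x)
    (h₂ : ∀ x ∈ Ω, deriv (fun s => v s x) t - b * Laplacian.laplacian (v t) x = F₂ x)
    (hform : ∀ x ∈ Ω, ∀ ξ η : ℝ, 0 ≤ a * Gpp (u t x) (v t x) * ξ ^ 2
      + (a + b) * Gpq (u t x) (v t x) * (ξ * η) + b * Gqq (u t x) (v t x) * η ^ 2) :
    IntegrableOn (fun x => Gp (u t x) (v t x) * F₁ x + Gq (u t x) (v t x) * F₂ x) Ω ∧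
    ∃ E' ≤ ∫ x in Ω, (Gp (u t x) (v t x) * F₁ x + Gq (u t x) (v t x) * F₂ x),
      HasDerivAt (fun s => ∫ x in Ω, G (u s x) (v s x)) E' t := by
  obtain ⟨K, hKΩ, hK, hsm⟩ := hu.exists_compact_abs_lt hΩ hb ht hT hκ
  obtain ⟨i1, d1⟩ := hu.hasDerivAt_integral_density hv hG hκ hΩ hb ht hT
  obtain ⟨i2, d2⟩ := setIntegral_diffusion_nonpos hG hΩ hK hKΩ (hu.contDiffOn_space t ht hT)
    (hv.contDiffOn_space t ht hT) (hsm t ⟨le_rfl, le_rfl⟩) hform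
  have heq : Set.EqOn (fun x => (Gp (u t x) (v t x) * deriv (fun s => u s x) t
      + Gq (u t x) (v t x) * deriv (fun s => v s x) t)
      - (a * Gp (u t x) (v t x) * Laplacian.laplacian (u t) x
        + b * Gq (u t x) (v t x) * Laplacian.laplacian (v t) x))
      (fun x => Gp (u t x) (v t x) * F₁ x + Gq (u t x) (v t x) * F₂ x) Ω := by
    intro x hx
    simp only [← h₁ x hx, ← h₂ x hx]
    ring
  refine ⟨(i1.sub i2).congr_fun heq hΩ.measurableSet, _, ?_, d1⟩
  rw [← setIntegral_congr_fun hΩ.measurableSet heq, integral_sub i1 i2]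
  linarith

end IsClassicalComponent

/-! ### Powers of positive parts and Grönwall's inequality. -/

lemma hasDerivAt_max_zero_pow (k : ℕ) (s : ℝ) :
    HasDerivAt (fun r : ℝ => max r 0 ^ (k + 2)) ((k + 2) * max s 0 ^ (k + 1)) s := by
  rcases lt_trichotomy s 0 with hs | rfl | hs
  · have h : HasDerivAt (fun _ : ℝ => (0 : ℝ)) 0 s := hasDerivAt_const _ _
    rw [max_eq_right hs.le, zero_pow (by omega), mul_zero]
    refine h.congr_of_eventuallyEq ?_
    filter_upwards [Iio_mem_nhds hs] with r hr
    rw [max_eq_right (le_of_lt hr), zero_pow (by omega)]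
  -- At the kink both one-sided derivatives are zero because the exponent is at least `2`.
  · rw [← hasDerivWithinAt_univ, ← Set.Iic_union_Ici (a := (0 : ℝ))]
    refine HasDerivWithinAt.union ?_ ?_
    · have h : HasDerivWithinAt (fun _ : ℝ => (0 : ℝ)) 0 (Set.Iic 0) 0 := hasDerivWithinAt_const _ _ _
      refine (h.congr_deriv (by simp)).congr (fun r hr => ?_) (by simp)
      rw [max_eq_right hr, zero_pow (by omega)]
    · have h := (hasDerivAt_pow (k + 2) (0 : ℝ)).hasDerivWithinAt (s := Set.Ici 0)
      refine (h.congr_deriv (by simp)).congr (fun r hr => ?_) (by simp)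
      rw [max_eq_left hr]
  · have h := hasDerivAt_pow (k + 2) s
    rw [max_eq_left hs.le]
    refine (h.congr_deriv (by push_cast; rfl)).congr_of_eventuallyEq ?_
    filter_upwards [Ioi_mem_nhds hs] with r hr
    rw [max_eq_left (le_of_lt hr)]

/-- Grönwall's inequality for a linear differential inequality with a rate of either sign. -/
lemma add_div_le_of_hasDerivAt_le {f : ℝ → ℝ} {k e s t : ℝ} (hk : k ≠ 0) (hst : s ≤ t)
    (h : ∀ r ∈ Set.Icc s t, ∃ f', HasDerivAt f f' r ∧ f' ≤ k * f r + e) :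
    f t + e / k ≤ (f s + e / k) * Real.exp (k * (t - s)) := by
  -- The shift by `e / k` makes the inequality homogeneous; the integrating factor then turns it
  -- into monotonicity.
  have hd : ∀ r ∈ Set.Icc s t, ∃ g' ≤ 0,
      HasDerivAt (fun r => (f r + e / k) * Real.exp (-k * r)) g' r := by
    intro r hr
    obtain ⟨f', h1, h2⟩ := h r hr
    have hexp : HasDerivAt (fun r : ℝ => Real.exp (-k * r)) (Real.exp (-k * r) * (-k)) r := by
      simpa using ((hasDerivAt_id r).const_mul (-k)).exp
    refine ⟨_, ?_, (h1.add_const (e / k)).mul hexp⟩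
    have h3 : k * (e / k) = e := mul_div_cancel₀ e hk
    have : f' * Real.exp (-k * r) + (f r + e / k) * (Real.exp (-k * r) * (-k))
        = (f' - (k * f r + k * (e / k))) * Real.exp (-k * r) := by ring
    rw [this, h3]
    exact mul_nonpos_of_nonpos_of_nonneg (by linarith) (Real.exp_pos _).le
  have hanti : AntitoneOn (fun r => (f r + e / k) * Real.exp (-k * r)) (Set.Icc s t) := by
    refine antitoneOn_of_deriv_nonpos (convex_Icc s t) ?_ ?_ ?_
    · intro r hr
      obtain ⟨g', -, hg⟩ := hd r hr
      exact hg.continuousAt.continuousWithinAt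
    · intro r hr
      obtain ⟨g', -, hg⟩ := hd r (interior_subset hr)
      exact hg.differentiableAt.differentiableWithinAt
    · intro r hr
      obtain ⟨g', hg', hg⟩ := hd r (interior_subset hr)
      rwa [hg.deriv]
  have hle := hanti (Set.left_mem_Icc.2 hst) (Set.right_mem_Icc.2 hst) hst
  simp only at hle
  have h1 : Real.exp (k * (t - s)) = Real.exp (-k * s) * Real.exp (k * t) := by
    rw [← Real.exp_add]; ring_nf
  have h2 : Real.exp (-k * t) * Real.exp (k * t) = 1 := by
    rw [← Real.exp_add]; simp
  calc f t + e / k = ((f t + e / k) * Real.exp (-k * t)) * Real.exp (k * t) := by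
        rw [mul_assoc, h2, mul_one]
    _ ≤ ((f s + e / k) * Real.exp (-k * s)) * Real.exp (k * t) :=
        mul_le_mul_of_nonneg_right hle (Real.exp_pos _).le
    _ = _ := by rw [h1]; ring

lemma integral_add_four {X : Type*} [MeasurableSpace X] {μ : Measure X} {f₁ f₂ f₃ f₄ : X → ℝ}
    (h₁ : Integrable f₁ μ) (h₂ : Integrable f₂ μ) (h₃ : Integrable f₃ μ) (h₄ : Integrable f₄ μ) :
    ∫ x, (f₁ x + f₂ x + f₃ x + f₄ x) ∂μ
      = ∫ x, f₁ x ∂μ + ∫ x, f₂ x ∂μ + ∫ x, f₃ x ∂μ + ∫ x, f₄ x ∂μ := by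
  have e₁ := integral_add ((h₁.add h₂).add h₃) h₄
  have e₂ := integral_add (h₁.add h₂) h₃
  have e₃ := integral_add h₁ h₂
  simp only [Pi.add_apply] at e₁ e₂ e₃
  rw [e₁, e₂, e₃]

/-! ### Nonnegativity of the solution. -/

/-- The part of `p` below the level `-ε`. -/
noncomputable def negExcess (ε p : ℝ) : ℝ := max (-p - ε) 0

lemma negExcess_nonneg (ε p : ℝ) : 0 ≤ negExcess ε p := le_max_right _ _

lemma neg_le_negExcess_add (ε p : ℝ) : -p ≤ negExcess ε p + ε := by
  have : -p - ε ≤ negExcess ε p := le_max_left _ _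
  linarith

lemma continuous_negExcess (ε : ℝ) : Continuous (negExcess ε) := by
  unfold negExcess; fun_prop

lemma negExcess_eq_zero {ε p : ℝ} (h : |p| < ε) : negExcess ε p = 0 :=
  max_eq_right (by linarith [neg_abs_le p])

lemma negExcess_anti {ε δ : ℝ} (h : ε ≤ δ) (p : ℝ) : negExcess δ p ≤ negExcess ε p :=
  max_le_max (by linarith) le_rfl

lemma hasDerivAt_negExcess_pow (ε : ℝ) (k : ℕ) (p : ℝ) :
    HasDerivAt (fun r => negExcess ε r ^ (k + 2)) (-((k + 2) * negExcess ε p ^ (k + 1))) p := by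
  have h := (hasDerivAt_max_zero_pow k (-p - ε)).comp p (((hasDerivAt_id p).neg).sub_const ε)
  simpa [negExcess, Function.comp_def] using h

/-- The cube is the lowest integer power of the truncation that is `C²`. The second variable is a
dummy, so that a single component fits the two-variable framework. -/
lemma isDensity_negExcess (ε : ℝ) : IsDensity ε (fun p _ => negExcess ε p ^ 3)
    (fun p _ => -(3 * negExcess ε p ^ 2)) (fun _ _ => 0) (fun p _ => 6 * negExcess ε p)
    (fun _ _ => 0) (fun _ _ => 0) where
  chain x y x' y' s hx _ := by
    have := (hasDerivAt_negExcess_pow ε 1 (x s)).comp s hx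
    norm_num [Function.comp_def] at this ⊢
    exact this
  chain_p x y x' y' s hx _ := by
    have := (((hasDerivAt_negExcess_pow ε 0 (x s)).comp s hx).const_mul 3).neg
    norm_num [Function.comp_def] at this ⊢
    refine this.congr_deriv ?_
    ring
  chain_q x y x' y' s _ _ := by simpa using hasDerivAt_const s (0 : ℝ)
  cont := ((continuous_negExcess ε).comp continuous_fst).pow 3
  cont_p := (continuous_const.mul (((continuous_negExcess ε).comp continuous_fst).pow 2)).neg
  cont_q := continuous_const
  cont_pp := continuous_const.mul ((continuous_negExcess ε).comp continuous_fst)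
  cont_pq := continuous_const
  cont_qq := continuous_const
  zero p _ h := by simp [negExcess_eq_zero h]
  zero_p p _ h := by simp [negExcess_eq_zero h]
  zero_q _ _ _ := rfl
  zero_pp p _ h := by simp [negExcess_eq_zero h]
  zero_pq _ _ _ := rfl
  zero_qq _ _ _ := rfl

lemma sq_mul_add_le {X Y ε : ℝ} (hX : 0 ≤ X) (hY : 0 ≤ Y) (hε : 0 ≤ ε) :
    X ^ 2 * (Y + ε) ≤ 5 * (X ^ 3 + Y ^ 3 + ε ^ 3) := by
  have h : ∀ A B : ℝ, 0 ≤ A → 0 ≤ B → A ^ 2 * B ≤ A ^ 3 + B ^ 3 := by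
    intro A B hA hB
    rcases le_total A B with h | h
    · have : A ^ 2 * B ≤ B ^ 2 * B := by gcongr
      nlinarith [pow_nonneg hA 3]
    · have : A ^ 2 * B ≤ A ^ 2 * A := by gcongr
      nlinarith [pow_nonneg hB 3]
  nlinarith [h X Y hX hY, h X ε hX hε, pow_nonneg hX 3, pow_nonneg hY 3, pow_nonneg hε 3]

/-- A reaction term with quasi-positivity defect controlled by two other components contributes
at most linearly to the growth of the cubes of the negative parts. -/
lemma negExcess_sq_mul_le {ε p F c₁ c₂ Y Z S : ℝ} (hε : 0 ≤ ε) (hc₁ : 0 ≤ c₁) (hc₂ : 0 ≤ c₂)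
    (hY : 0 ≤ Y) (hZ : 0 ≤ Z) (hSY : negExcess ε p ^ 3 + Y ^ 3 ≤ S)
    (hSZ : negExcess ε p ^ 3 + Z ^ 3 ≤ S)
    (hF : p < 0 → -F ≤ c₁ * (Y + ε) + c₂ * (Z + ε)) :
    -(3 * negExcess ε p ^ 2) * F ≤ 15 * (c₁ + c₂) * (S + ε ^ 3) := by
  have hX := negExcess_nonneg ε p
  have hS : 0 ≤ S := le_trans (by positivity) hSY
  by_cases hp : p < 0
  · have h1 := sq_mul_add_le hX hY hε
    have h2 := sq_mul_add_le hX hZ hε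
    have h3 : negExcess ε p ^ 2 * (-F) ≤ negExcess ε p ^ 2 * (c₁ * (Y + ε) + c₂ * (Z + ε)) :=
      mul_le_mul_of_nonneg_left (hF hp) (by positivity)
    have h4 : c₁ * (negExcess ε p ^ 2 * (Y + ε)) ≤ c₁ * (5 * (S + ε ^ 3)) :=
      mul_le_mul_of_nonneg_left (by linarith) hc₁
    have h5 : c₂ * (negExcess ε p ^ 2 * (Z + ε)) ≤ c₂ * (5 * (S + ε ^ 3)) :=
      mul_le_mul_of_nonneg_left (by linarith) hc₂
    linarith
  · have : negExcess ε p = 0 := max_eq_right (by linarith)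
    rw [this]
    have : 0 ≤ 15 * (c₁ + c₂) * (S + ε ^ 3) := by positivity
    simpa using this

namespace IsClassicalComponent

variable {N : ℕ} {Ω : Set (EuclideanSpace ℝ (Fin N))} {T : EReal}
  {u : ℝ → EuclideanSpace ℝ (Fin N) → ℝ} {t ε a : ℝ}

/-- As the initial datum is nonnegative, one factor of the cube is at most `|u t - u 0|`; the other
two are bounded by `M`. Convergence in `L¹` is then enough. -/
lemma tendsto_integral_negExcess (hu : IsClassicalComponent Ω T u) (hΩ : IsOpen Ω)
    (hb : Bornology.IsBounded Ω) (hT : 0 < T) (hε : 0 < ε) :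
    Tendsto (fun t => ∫ x in Ω, negExcess ε (u t x) ^ 3) (𝓝[>] 0) (𝓝 0) := by
  obtain ⟨t₁, h0, ht₁⟩ := exists_gt_coe_lt (t := 0) (T := T) (by simpa using hT)
  obtain ⟨M, hM⟩ := hu.locally_bounded t₁ ht₁
  have hev : ∀ᶠ t : ℝ in 𝓝[>] 0, 0 < t ∧ t ≤ t₁ := by
    filter_upwards [self_mem_nhdsWithin, nhdsWithin_le_nhds (Iio_mem_nhds h0)] with t h1 h2
    exact ⟨h1, le_of_lt h2⟩
  have hlim : Tendsto (fun t => ENNReal.ofReal (M ^ 2) *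
      eLpNorm (fun x => u t x - u 0 x) 1 (volume.restrict Ω)) (𝓝[>] 0) (𝓝 0) := by
    simpa using ENNReal.Tendsto.const_mul hu.initial_tendsto (Or.inr ENNReal.ofReal_ne_top)
  have h := tendsto_integral_of_L1 (μ := volume.restrict Ω) (l := 𝓝[>] (0 : ℝ)) (fun _ => (0 : ℝ))
    (F := fun t x => negExcess ε (u t x) ^ 3) (integrable_zero _ _ _).aestronglyMeasurable ?_ ?_
  · simpa using h
  · filter_upwards [hev] with t ht
    exact hu.integrableOn_density hu (isDensity_negExcess ε) hε hΩ hb ht.1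
      (coe_lt_of_le_of_coe_lt ht.2 ht₁)
  · refine tendsto_of_tendsto_of_tendsto_of_le_of_le' tendsto_const_nhds hlim
      (Eventually.of_forall fun _ => zero_le) ?_
    filter_upwards [hev] with t ht
    rw [eLpNorm_one_eq_lintegral_enorm, ← lintegral_const_mul' _ _ ENNReal.ofReal_ne_top]
    refine lintegral_mono_ae ?_
    filter_upwards [hu.initial_nonneg, ae_restrict_mem hΩ.measurableSet] with x hx hxΩ
    have hX := negExcess_nonneg ε (u t x)
    have hux := abs_le.1 (hM t ht.1 ht.2 x hxΩ)
    have h1 : negExcess ε (u t x) ≤ M := max_le (by linarith) (by linarith)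
    have h2 : negExcess ε (u t x) ≤ |u t x - u 0 x| :=
      max_le (by linarith [neg_abs_le (u t x - u 0 x)]) (abs_nonneg _)
    rw [sub_zero, ← ofReal_norm, ← ofReal_norm, ← ENNReal.ofReal_mul (by positivity)]
    refine ENNReal.ofReal_le_ofReal ?_
    rw [Real.norm_of_nonneg (by positivity), Real.norm_eq_abs]
    calc negExcess ε (u t x) ^ 3 = negExcess ε (u t x) ^ 2 * negExcess ε (u t x) := by ring
      _ ≤ M ^ 2 * |u t x - u 0 x| := by gcongr

/-- If `u t x < 0`, the excess below a fixed level `-δ` is positive at `x`. Its integral is at most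
that for any smaller `ε`, hence zero in the limit, and continuity forces it to vanish at `x`. -/
lemma nonneg_of_integral_negExcess_le (hu : IsClassicalComponent Ω T u) (hΩ : IsOpen Ω)
    (hb : Bornology.IsBounded Ω) (ht : 0 < t) (htT : (t : EReal) < T) {C : ℝ}
    (hC : ∀ ε : ℝ, 0 < ε → ∫ x in Ω, negExcess ε (u t x) ^ 3 ≤ C * ε ^ 3) :
    ∀ x ∈ Ω, 0 ≤ u t x := by
  intro x hx
  by_contra! hneg
  set δ := -u t x / 2 with hδ
  have hδ0 : 0 < δ := by linarith
  have hint : ∀ ε : ℝ, 0 < ε → IntegrableOn (fun x => negExcess ε (u t x) ^ 3) Ω := fun ε hε =>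
    hu.integrableOn_density hu (isDensity_negExcess ε) hε hΩ hb ht htT
  have hle : ∫ x in Ω, negExcess δ (u t x) ^ 3 ≤ 0 := by
    have hlim : Tendsto (fun ε : ℝ => C * ε ^ 3) (𝓝[>] 0) (𝓝 0) := by
      have : Continuous fun ε : ℝ => C * ε ^ 3 := by fun_prop
      simpa using (this.tendsto 0).mono_left nhdsWithin_le_nhds
    refine ge_of_tendsto hlim ?_
    filter_upwards [self_mem_nhdsWithin, nhdsWithin_le_nhds (Iio_mem_nhds hδ0)] with ε h1 h2
    refine le_trans ?_ (hC ε h1)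
    refine integral_mono (hint δ hδ0) (hint ε h1) fun y => ?_
    exact pow_le_pow_left₀ (negExcess_nonneg _ _) (negExcess_anti (le_of_lt h2) _) 3
  have h0 : ∀ y, 0 ≤ negExcess δ (u t y) ^ 3 := fun y => pow_nonneg (negExcess_nonneg _ _) 3
  have hae := (setIntegral_eq_zero_iff_of_nonneg_ae (Eventually.of_forall h0) (hint δ hδ0)).1
    (le_antisymm hle (integral_nonneg h0))
  have hzero := Measure.eqOn_open_of_ae_eq hae hΩ
    (((continuous_negExcess δ).comp_continuousOn (hu.continuousOn_slice ht htT)).pow 3)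
    continuousOn_const hx
  have hpos : 0 < negExcess δ (u t x) := lt_max_of_lt_left (by linarith)
  have : negExcess δ (u t x) ^ 3 = 0 := hzero
  exact absurd this (pow_pos hpos 3).ne'

lemma exists_hasDerivAt_integral_negExcess_le (hu : IsClassicalComponent Ω T u) (hΩ : IsOpen Ω)
    (hb : Bornology.IsBounded Ω) (ht : 0 < t) (htT : (t : EReal) < T) (hε : 0 < ε) (ha : 0 < a)
    {F : EuclideanSpace ℝ (Fin N) → ℝ}
    (hF : ∀ x ∈ Ω, deriv (fun s => u s x) t - a * Laplacian.laplacian (u t) x = F x) :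
    IntegrableOn (fun x => -(3 * negExcess ε (u t x) ^ 2) * F x) Ω ∧
    ∃ E' ≤ ∫ x in Ω, -(3 * negExcess ε (u t x) ^ 2) * F x,
      HasDerivAt (fun s => ∫ x in Ω, negExcess ε (u s x) ^ 3) E' t := by
  have := hu.exists_hasDerivAt_integral_density_le hu (isDensity_negExcess ε) hε hΩ hb ht htT hF hF
    (fun x _ ξ η => by
      have := negExcess_nonneg ε (u t x)
      have : 0 ≤ a * (6 * negExcess ε (u t x)) * ξ ^ 2 := by positivity
      simpa using this)
  simpa only [zero_mul, add_zero] using this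

end IsClassicalComponent

namespace IsBrusselatorSolution

variable {N : ℕ} {P : BrusselatorParams} {Ω : Set (EuclideanSpace ℝ (Fin N))} {T : EReal}
  {u v w z : ℝ → EuclideanSpace ℝ (Fin N) → ℝ}

lemma exists_abs_le (hs : IsBrusselatorSolution P Ω T u v w z) {t₁ : ℝ} (ht₁ : (t₁ : EReal) < T) :
    ∃ M : ℝ, 0 ≤ M ∧ ∀ t : ℝ, 0 < t → t ≤ t₁ → ∀ x ∈ Ω,
      |u t x| ≤ M ∧ |v t x| ≤ M ∧ |w t x| ≤ M ∧ |z t x| ≤ M := by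
  obtain ⟨M₁, h₁⟩ := hs.comp_u.locally_bounded t₁ ht₁
  obtain ⟨M₂, h₂⟩ := hs.comp_v.locally_bounded t₁ ht₁
  obtain ⟨M₃, h₃⟩ := hs.comp_w.locally_bounded t₁ ht₁
  obtain ⟨M₄, h₄⟩ := hs.comp_z.locally_bounded t₁ ht₁
  refine ⟨|M₁| + |M₂| + |M₃| + |M₄|, by positivity, fun t h0 ht x hx => ?_⟩
  have := h₁ t h0 ht x hx
  have := h₂ t h0 ht x hx
  have := h₃ t h0 ht x hx
  have := h₄ t h0 ht x hx
  have := le_abs_self M₁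
  have := le_abs_self M₂
  have := le_abs_self M₃
  have := le_abs_self M₄
  have := abs_nonneg M₁
  have := abs_nonneg M₂
  have := abs_nonneg M₃
  have := abs_nonneg M₄
  refine ⟨?_, ?_, ?_, ?_⟩ <;> linarith

/-- The cubic production term can be negative only as far as its linear factor is. -/
lemma neg_cubic_le {M p q ε : ℝ} (hp : |p| ≤ M) (hε : 0 ≤ ε) :
    -(p ^ 2 * q) ≤ M ^ 2 * (negExcess ε q + ε) := by
  have h1 := neg_le_negExcess_add ε q
  have h2 : 0 ≤ negExcess ε q + ε := add_nonneg (negExcess_nonneg _ _) hε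
  have h3 : p ^ 2 ≤ M ^ 2 := sq_le_sq' (by linarith [neg_abs_le p]) ((le_abs_self p).trans hp)
  nlinarith [mul_le_mul_of_nonneg_left h1 (sq_nonneg p), mul_le_mul_of_nonneg_right h3 h2]

theorem nonneg (hs : IsBrusselatorSolution P Ω T u v w z) (hΩ : IsOpen Ω)
    (hb : Bornology.IsBounded Ω) {t : ℝ} (ht : 0 < t) (htT : (t : EReal) < T) :
    ∀ x ∈ Ω, 0 ≤ u t x ∧ 0 ≤ v t x ∧ 0 ≤ w t x ∧ 0 ≤ z t x := by
  obtain ⟨M, hM0, hM⟩ := hs.exists_abs_le htT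
  have hα := P.α_pos
  have hβ := P.β_pos
  have hD₁ := P.D₁_pos
  have hD₂ := P.D₂_pos
  have hD₃ := P.D₃_pos
  have hD₄ := P.D₄_pos
  -- The sum of the four rates `15 * (c₁ + c₂)` that `negExcess_sq_mul_le` yields for the four
  -- reaction terms.
  set A : ℝ := 15 * (2 * M ^ 2 + 2 * P.β + P.D₁ + P.D₂ + P.D₃ + P.D₄) with hA
  have hA0 : 0 < A := by positivity
  set m : ℝ := (volume Ω).toReal with hm
  have hm0 : 0 ≤ m := ENNReal.toReal_nonneg
  have hfin : volume Ω ≠ ⊤ := hb.measure_lt_top.ne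
  let y : ℝ → ℝ → ℝ := fun ε s => (((∫ x in Ω, negExcess ε (u s x) ^ 3) +
    ∫ x in Ω, negExcess ε (v s x) ^ 3) + ∫ x in Ω, negExcess ε (w s x) ^ 3) +
    ∫ x in Ω, negExcess ε (z s x) ^ 3
  have hy : ∀ ε : ℝ, 0 < ε → ∀ s : ℝ, 0 < s → s ≤ t →
      ∃ y', HasDerivAt (y ε) y' s ∧ y' ≤ A * y ε s + A * ε ^ 3 * m := by
    intro ε hε s hs0 hst
    have hsT := coe_lt_of_le_of_coe_lt hst htT
    obtain ⟨i1, e1, l1, d1⟩ := hs.comp_u.exists_hasDerivAt_integral_negExcess_le hΩ hb hs0 hsT hε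
      P.a_pos (hs.eq_u s hs0 hsT)
    obtain ⟨i2, e2, l2, d2⟩ := hs.comp_v.exists_hasDerivAt_integral_negExcess_le hΩ hb hs0 hsT hε
      P.b_pos (hs.eq_v s hs0 hsT)
    obtain ⟨i3, e3, l3, d3⟩ := hs.comp_w.exists_hasDerivAt_integral_negExcess_le hΩ hb hs0 hsT hε
      P.c_pos (hs.eq_w s hs0 hsT)
    obtain ⟨i4, e4, l4, d4⟩ := hs.comp_z.exists_hasDerivAt_integral_negExcess_le hΩ hb hs0 hsT hε
      P.d_pos (hs.eq_z s hs0 hsT)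
    have j1 := hs.comp_u.integrableOn_density hs.comp_u (isDensity_negExcess ε) hε hΩ hb hs0 hsT
    have j2 := hs.comp_v.integrableOn_density hs.comp_v (isDensity_negExcess ε) hε hΩ hb hs0 hsT
    have j3 := hs.comp_w.integrableOn_density hs.comp_w (isDensity_negExcess ε) hε hΩ hb hs0 hsT
    have j4 := hs.comp_z.integrableOn_density hs.comp_z (isDensity_negExcess ε) hε hΩ hb hs0 hsT
    refine ⟨_, ((d1.add d2).add d3).add d4, ?_⟩
    have key : ∫ x in Ω, (((-(3 * negExcess ε (u s x) ^ 2) * P.f (u s x) (v s x) (w s x) (z s x)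
        + -(3 * negExcess ε (v s x) ^ 2) * P.g (u s x) (v s x) (w s x) (z s x))
        + -(3 * negExcess ε (w s x) ^ 2) * P.h (u s x) (v s x) (w s x) (z s x))
        + -(3 * negExcess ε (z s x) ^ 2) * P.k (u s x) (v s x) (w s x) (z s x))
        ≤ ∫ x in Ω, (A * (((negExcess ε (u s x) ^ 3 + negExcess ε (v s x) ^ 3)
          + negExcess ε (w s x) ^ 3) + negExcess ε (z s x) ^ 3) + A * ε ^ 3) := by
      refine setIntegral_mono_on (((i1.add i2).add i3).add i4)
        (((((j1.add j2).add j3).add j4).const_mul A).add (integrableOn_const hfin))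
        hΩ.measurableSet fun x hx => ?_
      obtain ⟨b1, b2, b3, b4⟩ := hM s hs0 hst x hx
      generalize u s x = p at *
      generalize v s x = q at *
      generalize w s x = p' at *
      generalize z s x = q' at *
      have n1 := negExcess_nonneg ε p
      have n2 := negExcess_nonneg ε q
      have n3 := negExcess_nonneg ε p'
      have n4 := negExcess_nonneg ε q'
      have k1 := pow_nonneg n1 3
      have k2 := pow_nonneg n2 3
      have k3 := pow_nonneg n3 3
      have k4 := pow_nonneg n4 3
      have m1 := neg_le_negExcess_add ε p
      have m2 := neg_le_negExcess_add ε q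
      have m3 := neg_le_negExcess_add ε p'
      have m4 := neg_le_negExcess_add ε q'
      set S : ℝ := negExcess ε p ^ 3 + negExcess ε q ^ 3 + negExcess ε p' ^ 3 + negExcess ε q' ^ 3
        with hS
      have t1 := negExcess_sq_mul_le (S := S) (p := p) (F := P.f p q p' q') hε.le (sq_nonneg M)
        hD₁.le n2 n3 (by linarith) (by linarith) (fun hp => by
          have c1 := neg_cubic_le (q := q) b1 hε.le
          have c2 := mul_le_mul_of_nonneg_left m3 hD₁.le
          have c3 : (P.β + 1 + P.D₁) * p ≤ 0 :=
            mul_nonpos_of_nonneg_of_nonpos (by positivity) hp.le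
          simp only [BrusselatorParams.f]
          linarith)
      have t2 := negExcess_sq_mul_le (S := S) (p := q) (F := P.g p q p' q') hε.le hβ.le
        hD₂.le n1 n4 (by linarith) (by linarith) (fun hp => by
          have c1 := mul_le_mul_of_nonneg_left m1 hβ.le
          have c2 := mul_le_mul_of_nonneg_left m4 hD₂.le
          have c3 : (p ^ 2 + P.D₂) * q ≤ 0 :=
            mul_nonpos_of_nonneg_of_nonpos (by positivity) hp.le
          simp only [BrusselatorParams.g]
          linarith)
      have t3 := negExcess_sq_mul_le (S := S) (p := p') (F := P.h p q p' q') hε.le (sq_nonneg M)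
        hD₃.le n4 n1 (by linarith) (by linarith) (fun hp => by
          have c1 := neg_cubic_le (q := q') b3 hε.le
          have c2 := mul_le_mul_of_nonneg_left m1 hD₃.le
          have c3 : (P.β + 1 + P.D₃) * p' ≤ 0 :=
            mul_nonpos_of_nonneg_of_nonpos (by positivity) hp.le
          simp only [BrusselatorParams.h]
          linarith)
      have t4 := negExcess_sq_mul_le (S := S) (p := q') (F := P.k p q p' q') hε.le hβ.le
        hD₄.le n3 n2 (by linarith) (by linarith) (fun hp => by
          have c1 := mul_le_mul_of_nonneg_left m3 hβ.le
          have c2 := mul_le_mul_of_nonneg_left m2 hD₄.le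
          have c3 : (p' ^ 2 + P.D₄) * q' ≤ 0 :=
            mul_nonpos_of_nonneg_of_nonpos (by positivity) hp.le
          simp only [BrusselatorParams.k]
          linarith)
      calc _ ≤ 15 * (M ^ 2 + P.D₁) * (S + ε ^ 3) + 15 * (P.β + P.D₂) * (S + ε ^ 3)
            + 15 * (M ^ 2 + P.D₃) * (S + ε ^ 3) + 15 * (P.β + P.D₄) * (S + ε ^ 3) := by
              linarith
        _ = A * S + A * ε ^ 3 := by rw [hA]; ring
    have hadd : ∫ x in Ω, (A * (((negExcess ε (u s x) ^ 3 + negExcess ε (v s x) ^ 3)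
          + negExcess ε (w s x) ^ 3) + negExcess ε (z s x) ^ 3) + A * ε ^ 3)
        = (∫ x in Ω, A * (((negExcess ε (u s x) ^ 3 + negExcess ε (v s x) ^ 3)
          + negExcess ε (w s x) ^ 3) + negExcess ε (z s x) ^ 3)) + ∫ x in Ω, A * ε ^ 3 :=
      integral_add ((((j1.add j2).add j3).add j4).const_mul A) (integrableOn_const hfin)
    rw [integral_add_four i1 i2 i3 i4, hadd, integral_const_mul, integral_add_four j1 j2 j3 j4,
      setIntegral_const] at key
    simp only [smul_eq_mul, Measure.real, ← hm] at key
    simp only [y]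
    linarith
  have hlim : ∀ ε : ℝ, 0 < ε → Tendsto (y ε) (𝓝[>] 0) (𝓝 0) := by
    intro ε hε
    have hT : 0 < T := lt_trans (by exact_mod_cast ht) htT
    simpa using (((hs.comp_u.tendsto_integral_negExcess hΩ hb hT hε).add
      (hs.comp_v.tendsto_integral_negExcess hΩ hb hT hε)).add
      (hs.comp_w.tendsto_integral_negExcess hΩ hb hT hε)).add
      (hs.comp_z.tendsto_integral_negExcess hΩ hb hT hε)
  -- Grönwall on `[s, t]` followed by `s → 0` removes the initial value; only the truncation error
  -- of order `ε³` remains.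
  have hbound : ∀ ε : ℝ, 0 < ε → y ε t ≤ (m * Real.exp (A * t)) * ε ^ 3 := by
    intro ε hε
    have hlim' : Tendsto (fun s => (y ε s + ε ^ 3 * m) * Real.exp (A * (t - s))) (𝓝[>] 0)
        (𝓝 ((0 + ε ^ 3 * m) * Real.exp (A * (t - 0)))) := by
      refine ((hlim ε hε).add_const _).mul ?_
      have : Continuous fun s : ℝ => Real.exp (A * (t - s)) := by fun_prop
      exact (this.tendsto 0).mono_left nhdsWithin_le_nhds
    have hle : y ε t ≤ (0 + ε ^ 3 * m) * Real.exp (A * (t - 0)) := by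
      refine ge_of_tendsto hlim' ?_
      filter_upwards [self_mem_nhdsWithin, nhdsWithin_le_nhds (Iio_mem_nhds ht)] with s h1 h2
      have := add_div_le_of_hasDerivAt_le hA0.ne' (le_of_lt h2)
        (fun r hr => hy ε hε r (lt_of_lt_of_le h1 hr.1) hr.2)
      have hdiv : A * ε ^ 3 * m / A = ε ^ 3 * m := by field_simp
      rw [hdiv] at this
      have : 0 ≤ ε ^ 3 * m := by positivity
      linarith
    rw [sub_zero, zero_add] at hle
    linarith
  have hn : ∀ (f : EuclideanSpace ℝ (Fin N) → ℝ) (ε : ℝ),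
      0 ≤ ∫ x in Ω, negExcess ε (f x) ^ 3 := fun f ε =>
    integral_nonneg fun x => pow_nonneg (negExcess_nonneg _ _) 3
  intro x hx
  refine ⟨hs.comp_u.nonneg_of_integral_negExcess_le hΩ hb ht htT (C := m * Real.exp (A * t))
      (fun ε hε => ?_) x hx,
    hs.comp_v.nonneg_of_integral_negExcess_le hΩ hb ht htT (C := m * Real.exp (A * t))
      (fun ε hε => ?_) x hx,
    hs.comp_w.nonneg_of_integral_negExcess_le hΩ hb ht htT (C := m * Real.exp (A * t))
      (fun ε hε => ?_) x hx,
    hs.comp_z.nonneg_of_integral_negExcess_le hΩ hb ht htT (C := m * Real.exp (A * t))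
      (fun ε hε => ?_) x hx⟩ <;>
  · have := hbound ε hε
    simp only [y] at this
    have := hn (u t) ε
    have := hn (v t) ε
    have := hn (w t) ε
    have := hn (z t) ε
    linarith

end IsBrusselatorSolution

/-! ### Upper bounds of `v` and `z` by comparison with a paraboloid. -/

lemma deriv_deriv_nonpos_of_isLocalMax {g : ℝ → ℝ} {x : ℝ} (h : IsLocalMax g x)
    (hc : ContinuousAt g x) : deriv (deriv g) x ≤ 0 := by
  by_contra! hpos
  -- With a positive second derivative the point would also be a local minimum, so `g` would be
  -- locally constant.
  have hmin := isLocalMin_of_deriv_deriv_pos hpos h.deriv_eq_zero hc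
  have hconst : g =ᶠ[𝓝 x] fun _ => g x := by
    filter_upwards [h, hmin] with y h1 h2
    exact le_antisymm h1 h2
  have h0 : deriv (deriv g) x = 0 := by
    rw [hconst.deriv.deriv_eq]
    simp
  linarith

lemma deriv_nonneg_of_eventually_le_left {g : ℝ → ℝ} {s : ℝ} (hd : DifferentiableAt ℝ g s)
    (h : ∀ᶠ r in 𝓝[<] s, g r ≤ g s) : 0 ≤ deriv g s := by
  have hs := (hasDerivWithinAt_iff_tendsto_slope' (s := Set.Iio s) (by simp)).1
    hd.hasDerivAt.hasDerivWithinAt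
  refine ge_of_tendsto hs ?_
  filter_upwards [h, self_mem_nhdsWithin] with r h1 h2
  rw [slope_def_field]
  exact div_nonneg_of_nonpos (by linarith) (by linarith [Set.mem_Iio.1 h2])

/-- The second-derivative test on each of the `N` coordinate lines, to which `L ‖x‖²` contributes `2
L`. -/
lemma laplacian_le_of_isLocalMax_add_sq {N : ℕ} {Ω : Set (EuclideanSpace ℝ (Fin N))}
    (hΩ : IsOpen Ω) {f : EuclideanSpace ℝ (Fin N) → ℝ} (hf : ContDiffOn ℝ 2 f Ω)
    {y : EuclideanSpace ℝ (Fin N)} (hy : y ∈ Ω) {L : ℝ}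
    (h : IsLocalMax (fun x => f x + L * ‖x‖ ^ 2) y) :
    Laplacian.laplacian f y ≤ -(2 * N * L) := by
  have key : ∀ i, fderiv ℝ (fderiv ℝ f) y (EuclideanSpace.basisFun (Fin N) ℝ i)
      (EuclideanSpace.basisFun (Fin N) ℝ i) ≤ -(2 * L) := by
    intro i
    set e := EuclideanSpace.basisFun (Fin N) ℝ i
    have he : ‖e‖ = 1 := (EuclideanSpace.basisFun (Fin N) ℝ).norm_eq_one i
    have hline : Continuous fun r : ℝ => y + r • e := by fun_prop
    have hline0 : Tendsto (fun r : ℝ => y + r • e) (𝓝 0) (𝓝 y) := by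
      simpa using hline.tendsto 0
    set g : ℝ → ℝ := fun r => f (y + r • e) + L * (‖y‖ ^ 2 + 2 * r * inner ℝ y e + r ^ 2) with hg
    have hgeq : ∀ r : ℝ, g r = f (y + r • e) + L * ‖y + r • e‖ ^ 2 := by
      intro r
      rw [norm_add_sq_real, inner_smul_right, norm_smul, he, hg]
      simp only [Real.norm_eq_abs, mul_one, sq_abs]
      ring
    have hmax : IsLocalMax g 0 := by
      have := hline0.eventually h
      filter_upwards [this] with r hr
      rw [hgeq, hgeq]
      simpa using hr
    have hd : ∀ᶠ r in 𝓝 (0 : ℝ), HasDerivAt g (fderiv ℝ f (y + r • e) e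
        + L * (2 * inner ℝ y e + 2 * r)) r := by
      filter_upwards [hline0.eventually (hΩ.mem_nhds hy)] with r hr
      have h1 : HasFDerivAt f (fderiv ℝ f (y + r • e)) (y + r • e) :=
        ((hf.contDiffAt (hΩ.mem_nhds hr)).differentiableAt (by norm_num)).hasFDerivAt
      have h2 : HasDerivAt (fun r : ℝ => y + r • e) e r := by
        simpa using ((hasDerivAt_id r).smul_const e).const_add y
      have h3 : HasDerivAt (fun r : ℝ => L * (‖y‖ ^ 2 + 2 * r * inner ℝ y e + r ^ 2))
          (L * (2 * inner ℝ y e + 2 * r)) r := by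
        have h4 := ((((hasDerivAt_id r).const_mul 2).mul_const (inner ℝ y e)).const_add
          (‖y‖ ^ 2)).fun_add (hasDerivAt_pow 2 r)
        simpa using h4.const_mul L
      exact (h1.comp_hasDerivAt r h2).fun_add h3
    have hdd : HasDerivAt (fun r : ℝ => fderiv ℝ f (y + r • e) e
        + L * (2 * inner ℝ y e + 2 * r)) (fderiv ℝ (fderiv ℝ f) y e e + L * 2) 0 := by
      have h1 : HasDerivAt _ _ _ := hasLineDerivAt_fderiv_of_contDiffOn_two hΩ hf hy e
      have h2 : HasDerivAt (fun r : ℝ => L * (2 * inner ℝ y e + 2 * r)) (L * 2) 0 := by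
        simpa using (((hasDerivAt_id (0 : ℝ)).const_mul 2).const_add (2 * inner ℝ y e)).const_mul L
      exact h1.fun_add h2
    have heq : deriv g =ᶠ[𝓝 0] fun r : ℝ => fderiv ℝ f (y + r • e) e
        + L * (2 * inner ℝ y e + 2 * r) := hd.mono fun r hr => hr.deriv
    have hle := deriv_deriv_nonpos_of_isLocalMax hmax hd.self_of_nhds.continuousAt
    rw [heq.deriv_eq, hdd.deriv] at hle
    linarith
  rw [laplacian_eq_sum_fderiv_fderiv]
  calc _ ≤ ∑ _i : Fin N, -(2 * L) := Finset.sum_le_sum fun i _ => key i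
    _ = _ := by simp; ring

/-- At a contact point of `v` with the paraboloid `K - L ‖x‖²` that dominates it, the reaction
term of `v` is too large to be of the form `β u - u² v + D (z - v)` with `z ≤ v`. -/
lemma IsClassicalComponent.not_isMaxOn_of_reaction {N : ℕ} (hN : 1 ≤ N)
    {Ω : Set (EuclideanSpace ℝ (Fin N))} {T : EReal} {v : ℝ → EuclideanSpace ℝ (Fin N) → ℝ}
    (hv : IsClassicalComponent Ω T v) (hΩ : IsOpen Ω) {t₀ s b β D L p q : ℝ}
    {y : EuclideanSpace ℝ (Fin N)} (ht₀ : 0 < t₀) (hs : t₀ < s) (hsT : (s : EReal) < T)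
    (hy : y ∈ Ω) (hb : 0 < b) (hD : 0 ≤ D) (hL : β ^ 2 < b * L) (hv1 : 1 ≤ v s y)
    (hq : q ≤ v s y)
    (heq : deriv (fun r => v r y) s - b * Laplacian.laplacian (v s) y
      = β * p - p ^ 2 * v s y + D * (q - v s y))
    (hmax : ∀ r ∈ Set.Icc t₀ s, ∀ x ∈ Ω, v r x + L * ‖x‖ ^ 2 ≤ v s y + L * ‖y‖ ^ 2) : False := by
  have hs0 := ht₀.trans hs
  have h1 : 0 ≤ deriv (fun r => v r y) s := by
    refine deriv_nonneg_of_eventually_le_left (hv.differentiableAt_time s hs0 hsT y hy) ?_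
    filter_upwards [self_mem_nhdsWithin, nhdsWithin_le_nhds (Ioi_mem_nhds hs)] with r hr1 hr2
    have := hmax r ⟨le_of_lt hr2, le_of_lt hr1⟩ y hy
    linarith
  have h2 : Laplacian.laplacian (v s) y ≤ -(2 * N * L) := by
    refine laplacian_le_of_isLocalMax_add_sq hΩ (hv.contDiffOn_space s hs0 hsT) hy ?_
    filter_upwards [hΩ.mem_nhds hy] with x hx
    exact hmax s ⟨hs.le, le_rfl⟩ x hx
  have hL0 : 0 < L := pos_of_mul_pos_right ((sq_nonneg β).trans_lt hL) hb.le
  have hN' : (1 : ℝ) ≤ N := by exact_mod_cast hN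
  have h3 : b * Laplacian.laplacian (v s) y ≤ b * -(2 * N * L) := mul_le_mul_of_nonneg_left h2 hb.le
  have h4 : b * L ≤ N * (b * L) := le_mul_of_one_le_left (by positivity) hN'
  have h5 : D * (q - v s y) ≤ 0 := mul_nonpos_of_nonneg_of_nonpos hD (by linarith)
  have h6 : p ^ 2 * 1 ≤ p ^ 2 * v s y := mul_le_mul_of_nonneg_left hv1 (sq_nonneg p)
  -- The left side of `heq` is at least `2 b L`, while the right side is at most `β p - p² ≤ β² / 4
  -- < b L`.
  nlinarith [sq_nonneg (p - β / 2), sq_nonneg β]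

/-- A uniform bound of the components `v` and `z`, away from the initial time. -/
theorem IsBrusselatorSolution.exists_v_z_le {N : ℕ} (hN : 1 ≤ N) {P : BrusselatorParams}
    {Ω : Set (EuclideanSpace ℝ (Fin N))} {T : EReal}
    {u v w z : ℝ → EuclideanSpace ℝ (Fin N) → ℝ} (hs : IsBrusselatorSolution P Ω T u v w z)
    (hΩ : IsOpen Ω) (hb : Bornology.IsBounded Ω) {t₀ : ℝ} (ht₀ : 0 < t₀)
    (htT : (t₀ : EReal) < T) :
    ∃ M : ℝ, 0 ≤ M ∧ ∀ t : ℝ, t₀ ≤ t → (t : EReal) < T → ∀ x ∈ Ω, v t x ≤ M ∧ z t x ≤ M := by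
  obtain ⟨M, hM0, hM⟩ := hs.exists_abs_le htT
  obtain ⟨R, hR⟩ := hb.closure.exists_norm_le
  set L : ℝ := (P.β ^ 2 + 1) / P.b + (P.β ^ 2 + 1) / P.d with hL
  have hbp := P.b_pos
  have hdp := P.d_pos
  have hL0 : 0 < L := by positivity
  have hLb : P.β ^ 2 < P.b * L := by
    have : P.b * L = P.β ^ 2 + 1 + P.b * ((P.β ^ 2 + 1) / P.d) := by rw [hL]; field_simp
    have : 0 < P.b * ((P.β ^ 2 + 1) / P.d) := by positivity
    linarith
  have hLd : P.β ^ 2 < P.d * L := by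
    have : P.d * L = P.d * ((P.β ^ 2 + 1) / P.b) + (P.β ^ 2 + 1) := by rw [hL]; field_simp
    have : 0 < P.d * ((P.β ^ 2 + 1) / P.b) := by positivity
    linarith
  -- A maximum above `κ` has `max v z > M + 1`. This rules out the starting time, where the bound is
  -- `M`, and the boundary, where the value is `0`; it also supplies the value `≥ 1` needed at a
  -- contact point.
  set κ : ℝ := M + 1 + L * R ^ 2 with hκ
  have hnorm : ∀ x ∈ closure Ω, L * ‖x‖ ^ 2 ≤ L * R ^ 2 := fun x hx =>
    mul_le_mul_of_nonneg_left (pow_le_pow_left₀ (norm_nonneg _) (hR x hx) 2) hL0.le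
  have hκ0 : 0 ≤ κ := by positivity
  suffices H : ∀ t₁ : ℝ, t₀ ≤ t₁ → (t₁ : EReal) < T → ∀ x ∈ Ω,
      max (v t₁ x) (z t₁ x) + L * ‖x‖ ^ 2 ≤ κ by
    refine ⟨κ, hκ0, fun t ht htT' x hx => ?_⟩
    have h := H t ht htT' x hx
    have h1 := le_max_left (v t x) (z t x)
    have h2 := le_max_right (v t x) (z t x)
    have h3 : 0 ≤ L * ‖x‖ ^ 2 := by positivity
    constructor <;> linarith
  intro t₁ ht₁ ht₁T x hx
  have hsub : ∀ p ∈ Set.Icc t₀ t₁ ×ˢ closure Ω, 0 < p.1 ∧ (p.1 : EReal) < T ∧ p.2 ∈ closure Ω :=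
    fun p hp => ⟨ht₀.trans_le hp.1.1, coe_lt_of_le_of_coe_lt hp.1.2 ht₁T, hp.2⟩
  have hcont : ContinuousOn (fun p : ℝ × EuclideanSpace ℝ (Fin N) =>
      max (v p.1 p.2) (z p.1 p.2) + L * ‖p.2‖ ^ 2) (Set.Icc t₀ t₁ ×ˢ closure Ω) :=
    ((hs.comp_v.continuousOn.mono hsub).sup (hs.comp_z.continuousOn.mono hsub)).add
      (by fun_prop)
  obtain ⟨⟨s, y⟩, hmem, hmax⟩ := (isCompact_Icc.prod hb.isCompact_closure).exists_isMaxOn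
    ⟨(t₁, x), ⟨ht₁, le_rfl⟩, subset_closure hx⟩ hcont
  have hmax' : ∀ r ∈ Set.Icc t₀ t₁, ∀ x ∈ closure Ω,
      max (v r x) (z r x) + L * ‖x‖ ^ 2 ≤ max (v s y) (z s y) + L * ‖y‖ ^ 2 :=
    fun r hr x hx => hmax (show (r, x) ∈ Set.Icc t₀ t₁ ×ˢ closure Ω from ⟨hr, hx⟩)
  refine (hmax' t₁ ⟨ht₁, le_rfl⟩ x (subset_closure hx)).trans ?_
  by_contra! hlt
  have hs0 : 0 < s := (hsub _ hmem).1
  have hsT : (s : EReal) < T := (hsub _ hmem).2.1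
  have hyn := hnorm y hmem.2
  have hbig : M + 1 < max (v s y) (z s y) := by linarith
  have hyΩ : y ∈ Ω := by
    by_contra hyΩ
    have hfr : y ∈ frontier Ω := ⟨hmem.2, by rwa [hΩ.interior_eq]⟩
    rw [hs.comp_v.boundary s hs0 hsT y hfr, hs.comp_z.boundary s hs0 hsT y hfr, max_self] at hbig
    linarith
  have hts : t₀ < s := by
    refine lt_of_le_of_ne hmem.1.1 ?_
    rintro rfl
    obtain ⟨-, h1, -, h2⟩ := hM t₀ ht₀ le_rfl y hyΩ
    have : max (v t₀ y) (z t₀ y) ≤ M := max_le ((le_abs_self _).trans h1) ((le_abs_self _).trans h2)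
    linarith
  -- The equation of the larger component is the one to use: there the exchange term is nonpositive.
  rcases le_total (z s y) (v s y) with hvz | hvz
  · rw [max_eq_left hvz] at hbig hmax'
    refine hs.comp_v.not_isMaxOn_of_reaction hN hΩ ht₀ hts hsT hyΩ hbp P.D₂_pos.le hLb
      (by linarith) hvz (hs.eq_v s hs0 hsT y hyΩ) fun r hr x hx => ?_
    have h1 := hmax' r ⟨hr.1, hr.2.trans hmem.1.2⟩ x (subset_closure hx)
    have h2 := le_max_left (v r x) (z r x)
    linarith
  · rw [max_eq_right hvz] at hbig hmax'
    refine hs.comp_z.not_isMaxOn_of_reaction hN hΩ ht₀ hts hsT hyΩ hdp P.D₄_pos.le hLd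
      (by linarith) hvz (hs.eq_z s hs0 hsT y hyΩ) fun r hr x hx => ?_
    have h1 := hmax' r ⟨hr.1, hr.2.trans hmem.1.2⟩ x (subset_closure hx)
    have h2 := le_max_right (v r x) (z r x)
    linarith

/-! ### The Lyapunov density for one compartment. -/

/-- The part of `p` above the level `1`. -/
noncomputable def excess (p : ℝ) : ℝ := max (p - 1) 0

lemma excess_nonneg (p : ℝ) : 0 ≤ excess p := le_max_right _ _

lemma le_excess_add_one (p : ℝ) : p ≤ excess p + 1 := by
  have : p - 1 ≤ excess p := le_max_left _ _
  linarith

lemma continuous_excess : Continuous excess := by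
  unfold excess; fun_prop

lemma excess_eq_zero {p : ℝ} (h : |p| < 1) : excess p = 0 :=
  max_eq_right (by linarith [le_abs_self p])

lemma hasDerivAt_excess_pow (k : ℕ) (p : ℝ) :
    HasDerivAt (fun r => excess r ^ (k + 2)) ((k + 2) * excess p ^ (k + 1)) p := by
  have h := (hasDerivAt_max_zero_pow k (p - 1)).comp p ((hasDerivAt_id p).sub_const 1)
  simpa [excess, Function.comp_def] using h

/-- The density `U^m + m q U^(m-1) + (A q² + B) U^(m-2)` with `U = (p - 1)₊` and `m = k + 5`. -/
noncomputable def lyap (k : ℕ) (A B p q : ℝ) : ℝ :=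
  excess p ^ (k + 5) + (k + 5) * q * excess p ^ (k + 4) + (A * q ^ 2 + B) * excess p ^ (k + 3)

noncomputable def lyapP (k : ℕ) (A B p q : ℝ) : ℝ :=
  (k + 5) * excess p ^ (k + 4) + (k + 5) * (k + 4) * q * excess p ^ (k + 3)
    + (A * q ^ 2 + B) * (k + 3) * excess p ^ (k + 2)

noncomputable def lyapQ (k : ℕ) (A p q : ℝ) : ℝ :=
  (k + 5) * excess p ^ (k + 4) + 2 * A * q * excess p ^ (k + 3)

noncomputable def lyapPP (k : ℕ) (A B p q : ℝ) : ℝ :=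
  (k + 5) * (k + 4) * excess p ^ (k + 3) + (k + 5) * (k + 4) * (k + 3) * q * excess p ^ (k + 2)
    + (A * q ^ 2 + B) * (k + 3) * (k + 2) * excess p ^ (k + 1)

noncomputable def lyapPQ (k : ℕ) (A p q : ℝ) : ℝ :=
  (k + 5) * (k + 4) * excess p ^ (k + 3) + 2 * A * q * (k + 3) * excess p ^ (k + 2)

noncomputable def lyapQQ (k : ℕ) (A p : ℝ) : ℝ := 2 * A * excess p ^ (k + 3)

/-- The lowest power of `U` is `k + 3 ≥ 3`, so two derivatives survive the truncation. -/
lemma isDensity_lyap (k : ℕ) (A B : ℝ) : IsDensity 1 (lyap k A B) (lyapP k A B) (lyapQ k A)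
    (lyapPP k A B) (lyapPQ k A) (fun p _ => lyapQQ k A p) := by
  have hc := continuous_excess
  have hd : ∀ (j : ℕ) (x : ℝ → ℝ) (x' s : ℝ), HasDerivAt x x' s →
      HasDerivAt (fun r => excess (x r) ^ (j + 2)) ((j + 2) * excess (x s) ^ (j + 1) * x') s :=
    fun j x x' s hx => (hasDerivAt_excess_pow j (x s)).comp s hx
  constructor
  · intro x y x' y' s hx hy
    have h1 := hd (k + 3) x x' s hx
    have h2 := (hy.const_mul (k + 5 : ℝ)).fun_mul (hd (k + 2) x x' s hx)
    have h3 := (((hy.fun_pow 2).const_mul A).add_const B).fun_mul (hd (k + 1) x x' s hx)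
    refine ((h1.fun_add h2).fun_add h3).congr_deriv ?_
    simp only [lyapP, lyapQ]
    push_cast
    ring
  · intro x y x' y' s hx hy
    have h1 := (hd (k + 2) x x' s hx).const_mul (k + 5 : ℝ)
    have h2 := (hy.const_mul ((k + 5) * (k + 4) : ℝ)).fun_mul (hd (k + 1) x x' s hx)
    have h3 := ((((hy.fun_pow 2).const_mul A).add_const B).mul_const (k + 3 : ℝ)).fun_mul
      (hd k x x' s hx)
    refine ((h1.fun_add h2).fun_add h3).congr_deriv ?_
    simp only [lyapPP, lyapPQ]
    push_cast
    ring
  · intro x y x' y' s hx hy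
    have h1 := (hd (k + 2) x x' s hx).const_mul (k + 5 : ℝ)
    have h2 := (hy.const_mul (2 * A)).fun_mul (hd (k + 1) x x' s hx)
    refine (h1.fun_add h2).congr_deriv ?_
    simp only [lyapPQ, lyapQQ]
    push_cast
    ring
  · unfold lyap; fun_prop
  · unfold lyapP; fun_prop
  · unfold lyapQ; fun_prop
  · unfold lyapPP; fun_prop
  · unfold lyapPQ; fun_prop
  · unfold lyapQQ; fun_prop
  all_goals
    intro p q hp
    simp [lyap, lyapP, lyapQ, lyapPP, lyapPQ, lyapQQ, excess_eq_zero hp]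

lemma quadraticForm_nonneg {x y w : ℝ} (hx : 0 ≤ x) (hw : 0 ≤ w) (h : y ^ 2 ≤ 4 * x * w)
    (ξ η : ℝ) : 0 ≤ x * ξ ^ 2 + y * (ξ * η) + w * η ^ 2 := by
  rcases hx.eq_or_lt with rfl | hx
  · have : y = 0 := by
      have : y ^ 2 ≤ 0 := by linarith
      exact pow_eq_zero_iff two_ne_zero |>.1 (le_antisymm this (sq_nonneg y))
    subst this
    have : 0 ≤ w * η ^ 2 := by positivity
    linarith
  · have h1 : 0 ≤ (2 * x * ξ + y * η) ^ 2 + (4 * x * w - y ^ 2) * η ^ 2 :=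
      add_nonneg (sq_nonneg _) (mul_nonneg (by linarith) (sq_nonneg _))
    have h2 : 4 * x * (x * ξ ^ 2 + y * (ξ * η) + w * η ^ 2)
        = (2 * x * ξ + y * η) ^ 2 + (4 * x * w - y ^ 2) * η ^ 2 := by ring
    rw [← h2] at h1
    exact nonneg_of_mul_nonneg_right h1 (by positivity)

/-- For bounded `q` and suitable constants the diffusion acts dissipatively on `lyap`, whatever
the two diffusion coefficients are. -/
lemma exists_lyap_form_nonneg (k : ℕ) {a b M : ℝ} (ha : 0 < a) (hb : 0 < b) :
    ∃ A B : ℝ, 0 ≤ A ∧ 0 ≤ B ∧ ((k : ℝ) + 5) * (k + 4) ≤ 2 * A ∧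
      ∀ p q : ℝ, 0 ≤ q → q ≤ M → ∀ ξ η : ℝ,
        0 ≤ a * lyapPP k A B p q * ξ ^ 2 + (a + b) * lyapPQ k A p q * (ξ * η)
          + b * lyapQQ k A p * η ^ 2 := by
  set m₁ : ℝ := (k + 5) * (k + 4) with hm₁
  have hm₁0 : 0 < m₁ := by positivity
  -- The first summand controls the `U²` part of the discriminant; the extra `m₁` gives `m₁ ≤ 2 A`,
  -- which the reaction estimate needs.
  set A : ℝ := (a + b) ^ 2 * m₁ / (4 * (a * b)) + m₁ with hA
  have hA0 : 0 < A := by positivity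
  set m₂ : ℝ := 2 * A * (k + 3) with hm₂
  -- Chosen after `A`, since `m₂` depends on `A`: it absorbs the part of the discriminant coming
  -- from `q ≤ M`.
  set B : ℝ := (a + b) ^ 2 * m₂ ^ 2 * M ^ 2 / (4 * (a * b) * A) with hB
  have hB0 : 0 ≤ B := by positivity
  have hA1 : (a + b) ^ 2 * m₁ ≤ 4 * (a * b) * A := by
    have : 4 * (a * b) * A = (a + b) ^ 2 * m₁ + 4 * (a * b) * m₁ := by rw [hA]; field_simp
    have : 0 < 4 * (a * b) * m₁ := by positivity
    linarith
  have hB1 : (a + b) ^ 2 * m₂ ^ 2 * M ^ 2 = 4 * (a * b) * A * B := by rw [hB]; field_simp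
  have hAm : m₁ ≤ A := by
    have : 0 ≤ (a + b) ^ 2 * m₁ / (4 * (a * b)) := by positivity
    linarith
  clear_value A B m₂
  refine ⟨A, B, hA0.le, hB0, by linarith, fun p q hq hqM => ?_⟩
  set U := excess p with hU
  have hU0 : 0 ≤ U := excess_nonneg p
  have hPP : (m₁ * U ^ 2 + B) * U ^ (k + 1) ≤ lyapPP k A B p q := by
    have h1 : 0 ≤ m₁ * (k + 3) * q * U ^ (k + 2) := by positivity
    have h2 : 0 ≤ A * q ^ 2 * (k + 3) * (k + 2) * U ^ (k + 1) := by positivity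
    have h3 : B * U ^ (k + 1) ≤ ((k + 3) * (k + 2)) * (B * U ^ (k + 1)) :=
      le_mul_of_one_le_left (by positivity) (by
        have hk : (0 : ℝ) ≤ k := Nat.cast_nonneg k
        have : (k + 3) * (k + 2) = (k : ℝ) * k + 5 * k + 6 := by ring
        have : (0 : ℝ) ≤ k * k := by positivity
        linarith)
    have h4 : lyapPP k A B p q = m₁ * U ^ 2 * U ^ (k + 1) + m₁ * (k + 3) * q * U ^ (k + 2)
        + A * q ^ 2 * (k + 3) * (k + 2) * U ^ (k + 1)
        + ((k + 3) * (k + 2)) * (B * U ^ (k + 1)) := by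
      simp only [lyapPP, ← hU, hm₁]; ring
    rw [h4]
    linarith
  have hPQ : lyapPQ k A p q = U ^ (k + 2) * (m₁ * U + m₂ * q) := by
    simp only [lyapPQ, ← hU, hm₁, hm₂]; ring
  have hQQ : 0 ≤ lyapQQ k A p := by unfold lyapQQ; positivity
  refine quadraticForm_nonneg (mul_nonneg ha.le (le_trans (by positivity) hPP))
    (mul_nonneg hb.le hQQ) ?_
  have h1 : (m₁ * U + m₂ * q) ^ 2 ≤ 2 * m₁ ^ 2 * U ^ 2 + 2 * m₂ ^ 2 * M ^ 2 := by
    have : m₂ ^ 2 * q ^ 2 ≤ m₂ ^ 2 * M ^ 2 := by gcongr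
    linarith [sq_nonneg (m₁ * U - m₂ * q)]
  have h2 : (a + b) ^ 2 * (2 * m₁ ^ 2 * U ^ 2 + 2 * m₂ ^ 2 * M ^ 2)
      ≤ 8 * (a * b) * A * (m₁ * U ^ 2 + B) := by
    have : (a + b) ^ 2 * m₁ * (m₁ * U ^ 2) ≤ 4 * (a * b) * A * (m₁ * U ^ 2) := by gcongr
    linarith
  have h3 : (a + b) ^ 2 * (m₁ * U + m₂ * q) ^ 2 ≤ 8 * (a * b) * A * (m₁ * U ^ 2 + B) :=
    (mul_le_mul_of_nonneg_left h1 (sq_nonneg _)).trans h2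
  have h4 : ((a + b) * lyapPQ k A p q) ^ 2
      = (a + b) ^ 2 * (m₁ * U + m₂ * q) ^ 2 * (U ^ (k + 1) * U ^ (k + 3)) := by rw [hPQ]; ring
  have h5 : 8 * (a * b) * A * (m₁ * U ^ 2 + B) * (U ^ (k + 1) * U ^ (k + 3))
      = 4 * (a * ((m₁ * U ^ 2 + B) * U ^ (k + 1))) * (b * lyapQQ k A p) := by
    simp only [lyapQQ, ← hU]; ring
  rw [h4]
  refine (mul_le_mul_of_nonneg_right h3 (by positivity)).trans ?_
  rw [h5]
  have h6 := mul_le_mul_of_nonneg_left hPP ha.le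
  exact mul_le_mul_of_nonneg_right (mul_le_mul_of_nonneg_left h6 zero_le_four)
    (mul_nonneg hb.le hQQ)

lemma exists_lyap_le (k : ℕ) {A B M : ℝ} (hA : 0 ≤ A) (hB : 0 ≤ B) (hM : 0 ≤ M) :
    ∃ C : ℝ, 0 ≤ C ∧ ∀ p q : ℝ, 0 ≤ q → q ≤ M →
      lyap k A B p q ≤ C * (excess p + 1) ^ (k + 5) := by
  refine ⟨1 + (k + 5) * M + (A * M ^ 2 + B), by positivity, fun p q hq hqM => ?_⟩
  have hU := excess_nonneg p
  set Y := excess p + 1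
  have hY : 1 ≤ Y := by linarith
  have h1 : excess p ^ (k + 5) ≤ Y ^ (k + 5) := pow_le_pow_left₀ hU (by linarith) _
  have h2 : excess p ^ (k + 4) ≤ Y ^ (k + 5) :=
    (pow_le_pow_left₀ hU (by linarith) _).trans (pow_le_pow_right₀ hY (by omega))
  have h3 : excess p ^ (k + 3) ≤ Y ^ (k + 5) :=
    (pow_le_pow_left₀ hU (by linarith) _).trans (pow_le_pow_right₀ hY (by omega))
  calc lyap k A B p q ≤ Y ^ (k + 5) + (k + 5) * M * Y ^ (k + 5)
        + (A * M ^ 2 + B) * Y ^ (k + 5) := by unfold lyap; gcongr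
    _ = _ := by ring

/-- The reaction terms of one compartment: the diffusive exchange with the other compartment is
isolated, the rest is dissipative up to terms of lower order. -/
lemma exists_lyap_reaction_le (k : ℕ) {A B M α β D E : ℝ} (hA : 0 ≤ A) (hB : 0 ≤ B) (hM : 0 ≤ M)
    (hAk : ((k : ℝ) + 5) * (k + 4) ≤ 2 * A) (hα : 0 < α) (hβ : 0 < β) (hD : 0 < D) (hE : 0 < E) :
    ∃ C : ℝ, 0 ≤ C ∧ ∀ p q p' q' : ℝ, 0 ≤ p → 0 ≤ q → q ≤ M → 0 ≤ p' → 0 ≤ q' → q' ≤ M →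
      lyapP k A B p q * (α - (β + 1) * p + p ^ 2 * q + D * (p' - p))
        + lyapQ k A p q * (β * p - p ^ 2 * q + E * (q' - q))
      ≤ -((k + 5) * excess p ^ (k + 5)) + (k + 5) * (D * ((p' - p) * excess p ^ (k + 4)))
        + C * ((excess p + 1) ^ (k + 4) + (excess p' + 1) ^ (k + 4)) := by
  set c₁ : ℝ := (k + 5) * (k + 4) * M + (A * M ^ 2 + B) * (k + 3) with hc₁
  have hc₁0 : 0 ≤ c₁ := by positivity
  set C : ℝ := (A * M ^ 2 + B) * (k + 3) * M + (k + 5) * (α + E * M) + c₁ * (α + D)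
    + 2 * A * M * (β + E * M) with hC
  have hC0 : 0 ≤ C := by positivity
  clear_value C c₁
  refine ⟨C, hC0, fun p q p' q' hp hq hqM hp' hq' hqM' => ?_⟩
  have hU := excess_nonneg p
  have hU' := excess_nonneg p'
  -- Where `U = 0` both partial derivatives vanish; otherwise `p = U + 1`.
  rcases hU.eq_or_lt with h0 | hUpos
  · have : 0 ≤ C * ((excess p + 1) ^ (k + 4) + (excess p' + 1) ^ (k + 4)) := by positivity
    simpa [lyapP, lyapQ, ← h0] using this
  have hpY : p = excess p + 1 := by
    have h1 : ¬ (p - 1 ≤ 0) := fun h => hUpos.ne' (max_eq_right h)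
    have : excess p = p - 1 := max_eq_left (by linarith)
    linarith
  set U := excess p with hUdef
  have hZ := le_excess_add_one p'
  set Z := excess p' + 1 with hZdef
  have hZ1 : 1 ≤ Z := by linarith
  have hp1 : 1 ≤ p := by linarith
  have hUp : U ≤ p := by linarith
  rw [← hpY]
  set X := p ^ (k + 4) + Z ^ (k + 4) with hX
  have hpX : p ^ (k + 4) ≤ X := le_add_of_nonneg_right (by positivity)
  have hZX : p ^ (k + 3) * Z ≤ X := by
    rcases le_total p Z with h | h
    · calc p ^ (k + 3) * Z ≤ Z ^ (k + 3) * Z := by gcongr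
        _ = Z ^ (k + 4) := by ring
        _ ≤ X := le_add_of_nonneg_left (by positivity)
    · calc p ^ (k + 3) * Z ≤ p ^ (k + 3) * p := by gcongr
        _ = p ^ (k + 4) := by ring
        _ ≤ X := hpX
  have hU2 : U ^ (k + 2) ≤ p ^ (k + 2) := pow_le_pow_left₀ hU hUp _
  have hU2' : U ^ (k + 2) ≤ p ^ (k + 3) := hU2.trans (pow_le_pow_right₀ hp1 (by omega))
  have hU3 : U ^ (k + 3) ≤ p ^ (k + 3) := pow_le_pow_left₀ hU hUp _
  have hU4 : U ^ (k + 4) ≤ X := (pow_le_pow_left₀ hU hUp _).trans hpX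
  -- Remainders of `lyapP` and `lyapQ` after the common leading term `(k + 5) U^(k+4)`. That term
  -- multiplies the sum of the two reactions, in which `p² q` and `β p` cancel and `-p` survives.
  set R₁ : ℝ := (k + 5) * (k + 4) * q * U ^ (k + 3) + (A * q ^ 2 + B) * (k + 3) * U ^ (k + 2)
    with hR₁
  set R₂ : ℝ := 2 * A * q * U ^ (k + 3) with hR₂
  have hR₁0 : 0 ≤ R₁ := by positivity
  have hR₁' : R₁ ≤ c₁ * p ^ (k + 3) := by
    calc R₁ ≤ (k + 5) * (k + 4) * M * p ^ (k + 3) + (A * M ^ 2 + B) * (k + 3) * p ^ (k + 3) := by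
          rw [hR₁]; gcongr
      _ = _ := by rw [hc₁]; ring
  have hp34 : p ^ (k + 3) * p = p ^ (k + 4) := by ring
  have hpow3 : 0 ≤ p ^ (k + 3) := by positivity
  have e1 : p ^ 2 * q * (R₁ - R₂) ≤ (A * M ^ 2 + B) * (k + 3) * M * X := by
    -- By `hAk` the coefficient of `q U^(k+3)` in the difference is nonpositive; what is left has
    -- low enough degree to be multiplied by `p²`.
    have h1 : R₁ - R₂ ≤ (A * q ^ 2 + B) * (k + 3) * U ^ (k + 2) := by
      have : 0 ≤ (2 * A - (k + 5) * (k + 4)) * (q * U ^ (k + 3)) :=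
        mul_nonneg (by linarith) (by positivity)
      rw [hR₁, hR₂]
      linarith
    calc p ^ 2 * q * (R₁ - R₂) ≤ p ^ 2 * q * ((A * q ^ 2 + B) * (k + 3) * U ^ (k + 2)) := by
          gcongr
      _ ≤ p ^ 2 * M * ((A * M ^ 2 + B) * (k + 3) * p ^ (k + 2)) := by gcongr
      _ = (A * M ^ 2 + B) * (k + 3) * M * p ^ (k + 4) := by ring
      _ ≤ _ := by gcongr
  have e2 : (k + 5) * U ^ (k + 4) * (α + E * (q' - q)) ≤ (k + 5) * (α + E * M) * X := by
    calc (k + 5) * U ^ (k + 4) * (α + E * (q' - q)) ≤ (k + 5) * U ^ (k + 4) * (α + E * M) := by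
          gcongr; linarith
      _ ≤ (k + 5) * X * (α + E * M) := by gcongr
      _ = _ := by ring
  have e3 : R₁ * (α - (β + 1) * p + D * (p' - p)) ≤ c₁ * (α + D) * X := by
    have h1 : α - (β + 1) * p + D * (p' - p) ≤ α * p + D * Z := by
      have : D * p' ≤ D * Z := by gcongr
      have : α * 1 ≤ α * p := by gcongr
      have : 0 ≤ D * p := by positivity
      have : 0 ≤ (β + 1) * p := by positivity
      linarith
    calc R₁ * (α - (β + 1) * p + D * (p' - p)) ≤ R₁ * (α * p + D * Z) := by gcongr
      _ ≤ (c₁ * p ^ (k + 3)) * (α * p + D * Z) := by gcongr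
      _ = c₁ * (α * (p ^ (k + 3) * p) + D * (p ^ (k + 3) * Z)) := by ring
      _ ≤ c₁ * (α * X + D * X) := by rw [hp34]; gcongr
      _ = _ := by ring
  have e4 : R₂ * (β * p + E * (q' - q)) ≤ 2 * A * M * (β + E * M) * X := by
    have h1 : β * p + E * (q' - q) ≤ (β + E * M) * p := by
      have h2 : E * (q' - q) ≤ E * M := by gcongr; linarith
      have h3 : E * M * 1 ≤ E * M * p := by gcongr
      linarith
    calc R₂ * (β * p + E * (q' - q)) ≤ R₂ * ((β + E * M) * p) := by gcongr
      _ ≤ (2 * A * M * p ^ (k + 3)) * ((β + E * M) * p) := by rw [hR₂]; gcongr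
      _ = 2 * A * M * (β + E * M) * (p ^ (k + 3) * p) := by ring
      _ ≤ _ := by rw [hp34]; gcongr
  have e5 : (k + 5) * U ^ (k + 5) ≤ (k + 5) * U ^ (k + 4) * p := by
    calc (k + 5) * U ^ (k + 5) = (k + 5) * U ^ (k + 4) * U := by ring
      _ ≤ _ := by gcongr
  have hP : lyapP k A B p q = (k + 5) * U ^ (k + 4) + R₁ := by
    simp only [lyapP, ← hUdef, hR₁]; ring
  have hQ : lyapQ k A p q = (k + 5) * U ^ (k + 4) + R₂ := by
    simp only [lyapQ, ← hUdef, hR₂]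
  rw [hP, hQ]
  have hsum : C * X = (A * M ^ 2 + B) * (k + 3) * M * X + (k + 5) * (α + E * M) * X
      + c₁ * (α + D) * X + 2 * A * M * (β + E * M) * X := by rw [hC]; ring
  rw [hsum]
  linarith

/-! ### Uniform moment bounds of `u` and `w`. -/

lemma exists_mul_pow_le (j : ℕ) {c C : ℝ} (hc : 0 < c) (hC : 0 ≤ C) :
    ∃ D : ℝ, 0 ≤ D ∧ ∀ Y : ℝ, 0 ≤ Y → C * Y ^ j ≤ c * Y ^ (j + 1) + D := by
  refine ⟨C * (C / c) ^ j, by positivity, fun Y hY => ?_⟩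
  rcases le_total Y (C / c) with h | h
  · have h1 : C * Y ^ j ≤ C * (C / c) ^ j := by gcongr
    have : 0 ≤ c * Y ^ (j + 1) := by positivity
    linarith
  · have h1 : C ≤ c * Y := by rwa [div_le_iff₀' hc] at h
    have h2 : C * Y ^ j ≤ c * Y * Y ^ j := by gcongr
    have : 0 ≤ C * (C / c) ^ j := by positivity
    calc C * Y ^ j ≤ c * Y ^ (j + 1) := by rw [pow_succ]; linarith
      _ ≤ _ := by linarith

lemma IsClassicalComponent.integrableOn_excess_pow {N : ℕ} {Ω : Set (EuclideanSpace ℝ (Fin N))}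
    {T : EReal} {u : ℝ → EuclideanSpace ℝ (Fin N) → ℝ} (hu : IsClassicalComponent Ω T u)
    (hΩ : IsOpen Ω) (hb : Bornology.IsBounded Ω) (k : ℕ) {t : ℝ} (ht : 0 < t)
    (htT : (t : EReal) < T) : IntegrableOn (fun x => excess (u t x) ^ (k + 5)) Ω := by
  obtain ⟨K, hKΩ, hK, hsm⟩ := hu.exists_compact_abs_lt hΩ hb ht htT one_pos
  refine integrableOn_of_continuousOn_of_zero_off_compact hΩ hK hKΩ
    ((continuous_excess.comp_continuousOn (hu.continuousOn_slice ht htT)).pow _) fun x hx hxK => ?_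
  simp [excess_eq_zero (hsm t ⟨le_rfl, le_rfl⟩ x hx hxK)]

namespace IsBrusselatorSolution

variable {N : ℕ} {P : BrusselatorParams} {Ω : Set (EuclideanSpace ℝ (Fin N))} {T : EReal}
  {u v w z : ℝ → EuclideanSpace ℝ (Fin N) → ℝ}

/-- Exchange between the compartments does not increase the weighted sum of the powers. -/
lemma exchange_nonpos (j : ℕ) (p p' : ℝ) :
    (p' - p) * excess p ^ j + (p - p') * excess p' ^ j ≤ 0 := by
  have h : (p' - p) * excess p ^ j + (p - p') * excess p' ^ j
      = -((p' - p) * (excess p' ^ j - excess p ^ j)) := by ring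
  rw [h]
  refine neg_nonpos.2 ?_
  rcases le_total p p' with hle | hle
  · have : excess p ^ j ≤ excess p' ^ j :=
      pow_le_pow_left₀ (excess_nonneg p) (max_le_max (by linarith) le_rfl) j
    exact mul_nonneg (by linarith) (by linarith)
  · have : excess p' ^ j ≤ excess p ^ j :=
      pow_le_pow_left₀ (excess_nonneg p') (max_le_max (by linarith) le_rfl) j
    exact mul_nonneg_of_nonpos_of_nonpos (by linarith) (by linarith)

/-- Turns damping in `U^(k+5)` into damping in the density itself. One half of `μ` absorbs the
lower-order term, the other half dominates `κ G`; the `+ 1` in `Cg + 1` avoids a zero denominator.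
-/
lemma exists_neg_pow_add_le (k : ℕ) {c C Cg : ℝ} (hc : 0 < c) (hC : 0 ≤ C) (hCg : 0 ≤ Cg) :
    ∃ κ D : ℝ, 0 < κ ∧ 0 ≤ D ∧ ∀ U G : ℝ, 0 ≤ U → G ≤ Cg * (U + 1) ^ (k + 5) →
      -(c * U ^ (k + 5)) + C * (U + 1) ^ (k + 4) ≤ -κ * G + D := by
  set μ : ℝ := c / 2 ^ (k + 4) with hμ
  have hμ0 : 0 < μ := by positivity
  obtain ⟨D, hD0, hD⟩ := exists_mul_pow_le (k + 4) (c := μ / 2) (by positivity) hC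
  refine ⟨μ / 2 / (Cg + 1), D + c, by positivity, by positivity, fun U G hU hG => ?_⟩
  have h1 := hD (U + 1) (by linarith)
  have h2 : (U + 1) ^ (k + 5) ≤ 2 ^ (k + 4) * (U ^ (k + 5) + 1 ^ (k + 5)) :=
    add_pow_le hU zero_le_one (k + 5)
  have h3 : μ * (U + 1) ^ (k + 5) ≤ c * (U ^ (k + 5) + 1) := by
    calc μ * (U + 1) ^ (k + 5) ≤ μ * (2 ^ (k + 4) * (U ^ (k + 5) + 1 ^ (k + 5))) := by gcongr
      _ = c * (U ^ (k + 5) + 1) := by rw [hμ, one_pow]; field_simp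
  have h4 : μ / 2 / (Cg + 1) * G ≤ μ / 2 * (U + 1) ^ (k + 5) := by
    calc μ / 2 / (Cg + 1) * G ≤ μ / 2 / (Cg + 1) * ((Cg + 1) * (U + 1) ^ (k + 5)) := by
          have : Cg * (U + 1) ^ (k + 5) ≤ (Cg + 1) * (U + 1) ^ (k + 5) := by gcongr; linarith
          gcongr
          linarith
      _ = _ := by field_simp
  linarith

/-- Uniform bounds of arbitrarily high moments, away from the initial time. -/
theorem exists_integral_excess_pow_le (hN : 1 ≤ N) (hs : IsBrusselatorSolution P Ω T u v w z)
    (hΩ : IsOpen Ω) (hb : Bornology.IsBounded Ω) (k : ℕ) {t₀ : ℝ} (ht₀ : 0 < t₀)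
    (htT : (t₀ : EReal) < T) :
    ∃ C : ℝ, ∀ t : ℝ, t₀ ≤ t → (t : EReal) < T →
      IntegrableOn (fun x => excess (u t x) ^ (k + 5) + excess (w t x) ^ (k + 5)) Ω ∧
      ∫ x in Ω, (excess (u t x) ^ (k + 5) + excess (w t x) ^ (k + 5)) ≤ C := by
  obtain ⟨M, hM0, hM⟩ := hs.exists_v_z_le hN hΩ hb ht₀ htT
  have hα := P.α_pos
  have hβ := P.β_pos
  have hD₁ := P.D₁_pos
  have hD₂ := P.D₂_pos
  have hD₃ := P.D₃_pos
  have hD₄ := P.D₄_pos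
  obtain ⟨A, B, hA, hB, hAk, hform⟩ := exists_lyap_form_nonneg k (M := M) P.a_pos P.b_pos
  obtain ⟨A', B', hA', hB', hAk', hform'⟩ := exists_lyap_form_nonneg k (M := M) P.c_pos P.d_pos
  obtain ⟨C₁, hC₁, hr₁⟩ := exists_lyap_reaction_le k hA hB hM0 hAk hα hβ hD₁ hD₂
  obtain ⟨C₂, hC₂, hr₂⟩ := exists_lyap_reaction_le k hA' hB' hM0 hAk' hα hβ hD₃ hD₄
  obtain ⟨Cg, hCg, hg⟩ := exists_lyap_le k hA hB hM0
  obtain ⟨Cg', hCg', hg'⟩ := exists_lyap_le k hA' hB' hM0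
  set Cr := P.D₁⁻¹ * C₁ + P.D₃⁻¹ * C₂ with hCr
  have hk : (0 : ℝ) < k + 5 := by positivity
  obtain ⟨κ₁, E₁, hκ₁, hE₁, hd₁⟩ := exists_neg_pow_add_le k (c := P.D₁⁻¹ * (k + 5)) (C := Cr)
    (Cg := Cg * P.D₁⁻¹) (by positivity) (by positivity) (by positivity)
  obtain ⟨κ₂, E₂, hκ₂, hE₂, hd₂⟩ := exists_neg_pow_add_le k (c := P.D₃⁻¹ * (k + 5)) (C := Cr)
    (Cg := Cg' * P.D₃⁻¹) (by positivity) (by positivity) (by positivity)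
  set κ := min κ₁ κ₂ with hκ
  have hκ0 : 0 < κ := lt_min hκ₁ hκ₂
  set m : ℝ := volume.real Ω with hm
  have hm0 : 0 ≤ m := measureReal_nonneg
  have hfin : volume Ω ≠ ⊤ := hb.measure_lt_top.ne
  have hlyap0 : ∀ A B p q : ℝ, 0 ≤ A → 0 ≤ B → 0 ≤ q → excess p ^ (k + 5) ≤ lyap k A B p q := by
    intro A B p q hA hB hq
    have := excess_nonneg p
    have h1 : 0 ≤ (k + 5) * q * excess p ^ (k + 4) := by positivity
    have h2 : 0 ≤ (A * q ^ 2 + B) * excess p ^ (k + 3) := by positivity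
    unfold lyap
    linarith
  have hnn : ∀ t : ℝ, t₀ ≤ t → (t : EReal) < T → ∀ x ∈ Ω,
      0 ≤ u t x ∧ 0 ≤ v t x ∧ 0 ≤ w t x ∧ 0 ≤ z t x := fun t ht htT' =>
    hs.nonneg hΩ hb (ht₀.trans_le ht) htT'
  -- These weights give the two exchange terms the same coefficient, so that `exchange_nonpos`
  -- applies to their sum.
  let y : ℝ → ℝ := fun t => P.D₁⁻¹ * (∫ x in Ω, lyap k A B (u t x) (v t x))
    + P.D₃⁻¹ * ∫ x in Ω, lyap k A' B' (w t x) (z t x)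
  have hy : ∀ t : ℝ, t₀ ≤ t → (t : EReal) < T →
      ∃ y', HasDerivAt y y' t ∧ y' ≤ -κ * y t + (E₁ + E₂) * m := by
    intro t ht htT'
    have ht0 := ht₀.trans_le ht
    have j₁ := hs.comp_u.integrableOn_density hs.comp_v (isDensity_lyap k A B) one_pos hΩ hb ht0 htT'
    have j₂ := hs.comp_w.integrableOn_density hs.comp_z (isDensity_lyap k A' B') one_pos hΩ hb ht0
      htT'
    obtain ⟨i₁, e₁, l₁, d₁⟩ := hs.comp_u.exists_hasDerivAt_integral_density_le hs.comp_v
      (isDensity_lyap k A B) one_pos hΩ hb ht0 htT' (hs.eq_u t ht0 htT') (hs.eq_v t ht0 htT')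
      (fun x hx => hform _ _ (hnn t ht htT' x hx).2.1 (hM t ht htT' x hx).1)
    obtain ⟨i₂, e₂, l₂, d₂⟩ := hs.comp_w.exists_hasDerivAt_integral_density_le hs.comp_z
      (isDensity_lyap k A' B') one_pos hΩ hb ht0 htT' (hs.eq_w t ht0 htT') (hs.eq_z t ht0 htT')
      (fun x hx => hform' _ _ (hnn t ht htT' x hx).2.2.2 (hM t ht htT' x hx).2)
    refine ⟨_, (d₁.const_mul P.D₁⁻¹).add (d₂.const_mul P.D₃⁻¹), ?_⟩
    have key := setIntegral_mono_on ((i₁.const_mul P.D₁⁻¹).add (i₂.const_mul P.D₃⁻¹))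
      (((((j₁.const_mul P.D₁⁻¹).add (j₂.const_mul P.D₃⁻¹))).const_mul (-κ)).add
        (integrableOn_const (C := E₁ + E₂) hfin)) hΩ.measurableSet (fun x hx => by
        obtain ⟨n₁, n₂, n₃, n₄⟩ := hnn t ht htT' x hx
        obtain ⟨b₂, b₄⟩ := hM t ht htT' x hx
        simp only [Pi.add_apply, BrusselatorParams.f, BrusselatorParams.g, BrusselatorParams.h,
          BrusselatorParams.k]
        generalize u t x = p at *
        generalize v t x = q at *
        generalize w t x = p' at *
        generalize z t x = q' at *
        have r₁ := mul_le_mul_of_nonneg_left (hr₁ p q p' q' n₁ n₂ b₂ n₃ n₄ b₄)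
          (inv_nonneg.2 hD₁.le)
        have r₂ := mul_le_mul_of_nonneg_left (hr₂ p' q' p q n₃ n₄ b₄ n₁ n₂ b₂)
          (inv_nonneg.2 hD₃.le)
        have hex := mul_nonpos_of_nonneg_of_nonpos hk.le (exchange_nonpos (k + 4) p p')
        have c₁ : P.D₁⁻¹ * ((k + 5) * (P.D₁ * ((p' - p) * excess p ^ (k + 4))))
            = (k + 5) * ((p' - p) * excess p ^ (k + 4)) := by field_simp
        have c₂ : P.D₃⁻¹ * ((k + 5) * (P.D₃ * ((p - p') * excess p' ^ (k + 4))))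
            = (k + 5) * ((p - p') * excess p' ^ (k + 4)) := by field_simp
        have s₁ := hd₁ (excess p) (P.D₁⁻¹ * lyap k A B p q) (excess_nonneg p) (by
          have := mul_le_mul_of_nonneg_left (hg p q n₂ b₂) (inv_nonneg.2 hD₁.le)
          linarith)
        have s₂ := hd₂ (excess p') (P.D₃⁻¹ * lyap k A' B' p' q') (excess_nonneg p') (by
          have := mul_le_mul_of_nonneg_left (hg' p' q' n₄ b₄) (inv_nonneg.2 hD₃.le)
          linarith)
        have g₁ : 0 ≤ P.D₁⁻¹ * lyap k A B p q := mul_nonneg (inv_nonneg.2 hD₁.le)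
          ((pow_nonneg (excess_nonneg p) _).trans (hlyap0 A B p q hA hB n₂))
        have g₂ : 0 ≤ P.D₃⁻¹ * lyap k A' B' p' q' := mul_nonneg (inv_nonneg.2 hD₃.le)
          ((pow_nonneg (excess_nonneg p') _).trans (hlyap0 A' B' p' q' hA' hB' n₄))
        have f₁ := mul_le_mul_of_nonneg_right (min_le_left κ₁ κ₂) g₁
        have f₂ := mul_le_mul_of_nonneg_right (min_le_right κ₁ κ₂) g₂
        rw [← hκ] at f₁ f₂
        have hsplit : P.D₁⁻¹ * (C₁ * ((excess p + 1) ^ (k + 4) + (excess p' + 1) ^ (k + 4)))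
            + P.D₃⁻¹ * (C₂ * ((excess p' + 1) ^ (k + 4) + (excess p + 1) ^ (k + 4)))
            = Cr * (excess p + 1) ^ (k + 4) + Cr * (excess p' + 1) ^ (k + 4) := by rw [hCr]; ring
        refine (add_le_add r₁ r₂).trans ?_
        linarith)
    have k₁ := integral_add (i₁.const_mul P.D₁⁻¹) (i₂.const_mul P.D₃⁻¹)
    have k₂ := integral_add ((((j₁.const_mul P.D₁⁻¹).add (j₂.const_mul P.D₃⁻¹))).const_mul (-κ))
        (integrableOn_const (C := E₁ + E₂) hfin)
    have k₃ := integral_add (j₁.const_mul P.D₁⁻¹) (j₂.const_mul P.D₃⁻¹)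
    simp only [Pi.add_apply] at key k₁ k₂ k₃
    rw [k₁, k₂, integral_const_mul, integral_const_mul, integral_const_mul, k₃, integral_const_mul,
      integral_const_mul, setIntegral_const, smul_eq_mul, ← hm] at key
    have q₁ := mul_le_mul_of_nonneg_left l₁ (inv_nonneg.2 hD₁.le)
    have q₂ := mul_le_mul_of_nonneg_left l₂ (inv_nonneg.2 hD₃.le)
    simp only [y]
    linarith
  refine ⟨(P.D₁ + P.D₃) * (|y t₀| + (E₁ + E₂) * m / κ), fun t ht htT' => ?_⟩
  have ht0 := ht₀.trans_le ht
  have j₁ := hs.comp_u.integrableOn_density hs.comp_v (isDensity_lyap k A B) one_pos hΩ hb ht0 htT'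
  have j₂ := hs.comp_w.integrableOn_density hs.comp_z (isDensity_lyap k A' B') one_pos hΩ hb ht0
    htT'
  have i₁ := hs.comp_u.integrableOn_excess_pow hΩ hb k ht0 htT'
  have i₂ := hs.comp_w.integrableOn_excess_pow hΩ hb k ht0 htT'
  refine ⟨i₁.add i₂, ?_⟩
  -- Grönwall with the negative rate `-κ`, hence a bound that does not grow with `t`.
  have hyt : y t ≤ |y t₀| + (E₁ + E₂) * m / κ := by
    have hgr := add_div_le_of_hasDerivAt_le (f := y) (neg_ne_zero.2 hκ0.ne') ht
      (fun r hr => hy r hr.1 (coe_lt_of_le_of_coe_lt hr.2 htT'))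
    rw [div_neg] at hgr
    set X := (E₁ + E₂) * m / κ with hX
    have hX0 : 0 ≤ X := by positivity
    set ex := Real.exp (-κ * (t - t₀)) with hex
    have hex0 : 0 < ex := Real.exp_pos _
    have hex1 : ex ≤ 1 := Real.exp_le_one_iff.2 (by nlinarith)
    have h1 : y t₀ * ex ≤ |y t₀| * 1 :=
      mul_le_mul (le_abs_self _) hex1 hex0.le (abs_nonneg _)
    have h2 : 0 ≤ X * ex := by positivity
    linarith
  have c₁ : ∫ x in Ω, excess (u t x) ^ (k + 5) ≤ ∫ x in Ω, lyap k A B (u t x) (v t x) :=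
    setIntegral_mono_on i₁ j₁ hΩ.measurableSet fun x hx =>
      hlyap0 _ _ _ _ hA hB (hnn t ht htT' x hx).2.1
  have c₂ : ∫ x in Ω, excess (w t x) ^ (k + 5) ≤ ∫ x in Ω, lyap k A' B' (w t x) (z t x) :=
    setIntegral_mono_on i₂ j₂ hΩ.measurableSet fun x hx =>
      hlyap0 _ _ _ _ hA' hB' (hnn t ht htT' x hx).2.2.2
  have p₁ : 0 ≤ ∫ x in Ω, excess (u t x) ^ (k + 5) :=
    integral_nonneg fun x => pow_nonneg (excess_nonneg _) _
  have p₂ : 0 ≤ ∫ x in Ω, excess (w t x) ^ (k + 5) :=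
    integral_nonneg fun x => pow_nonneg (excess_nonneg _) _
  rw [integral_add i₁ i₂]
  set I₁ := ∫ x in Ω, lyap k A B (u t x) (v t x) with hI₁
  set I₂ := ∫ x in Ω, lyap k A' B' (w t x) (z t x) with hI₂
  have hI₁0 := p₁.trans c₁
  have hI₂0 := p₂.trans c₂
  -- Adding nonnegative cross terms completes `I₁ + I₂` to a multiple of the weighted sum `y t`.
  calc _ ≤ I₁ + I₂ := add_le_add c₁ c₂
    _ ≤ I₁ + I₂ + (P.D₃ * (P.D₁⁻¹ * I₁) + P.D₁ * (P.D₃⁻¹ * I₂)) :=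
        le_add_of_nonneg_right (by positivity)
    _ = (P.D₁ + P.D₃) * (P.D₁⁻¹ * I₁ + P.D₃⁻¹ * I₂) := by field_simp; ring
    _ ≤ _ := mul_le_mul_of_nonneg_left hyt (by positivity)

end IsBrusselatorSolution

/-! ### From moment bounds to `L_n`. -/

lemma abs_lyapunovPoly_le {n : ℕ} {θ σ ρ : ℕ → ℝ} (hθ : ∀ i, 0 ≤ θ i) (hσ : ∀ i, 0 ≤ σ i)
    (hρ : ∀ i, 0 ≤ ρ i) {u v w z s : ℝ} (hu : |u| ≤ s) (hv : |v| ≤ s) (hw : |w| ≤ s)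
    (hz : |z| ≤ s) :
    |lyapunovPoly n θ σ ρ u v w z| ≤ lyapunovPoly n θ σ ρ 1 1 1 1 * s ^ n := by
  have hs : 0 ≤ s := (abs_nonneg u).trans hu
  unfold lyapunovPoly
  rw [Finset.sum_mul]
  refine (Finset.abs_sum_le_sum_abs _ _).trans (Finset.sum_le_sum fun p hp => ?_)
  rw [Finset.sum_mul]
  refine (Finset.abs_sum_le_sum_abs _ _).trans (Finset.sum_le_sum fun q hq => ?_)
  rw [Finset.sum_mul]
  refine (Finset.abs_sum_le_sum_abs _ _).trans (Finset.sum_le_sum fun r hr => ?_)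
  rw [Finset.mem_range] at hp hq hr
  have h1 := hθ r
  have h2 := hσ q
  have h3 := hρ p
  have hc : 0 ≤ (n.choose p : ℝ) * (p.choose q : ℝ) * (q.choose r : ℝ) * (θ r * σ q * ρ p) := by
    positivity
  rw [abs_mul, abs_of_nonneg hc, abs_mul, abs_mul, abs_mul, abs_pow, abs_pow, abs_pow, abs_pow]
  simp only [one_pow, mul_one]
  refine mul_le_mul_of_nonneg_left ?_ hc
  calc |u| ^ r * |v| ^ (q - r) * |w| ^ (p - q) * |z| ^ (n - p)
      ≤ s ^ r * s ^ (q - r) * s ^ (p - q) * s ^ (n - p) := by gcongr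
    _ = s ^ n := by
        rw [← pow_add, ← pow_add, ← pow_add]
        -- The exponents add up to `n` because `r ≤ q ≤ p ≤ n`.
        congr 1
        omega

lemma lyapunovPoly_one_nonneg {n : ℕ} {θ σ ρ : ℕ → ℝ} (hθ : ∀ i, 0 ≤ θ i) (hσ : ∀ i, 0 ≤ σ i)
    (hρ : ∀ i, 0 ≤ ρ i) : 0 ≤ lyapunovPoly n θ σ ρ 1 1 1 1 := by
  have h := abs_lyapunovPoly_le (n := n) hθ hσ hρ (s := 1) (u := 1) (v := 1) (w := 1) (z := 1)
    (by simp) (by simp) (by simp) (by simp)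
  rw [one_pow, mul_one] at h
  exact (abs_nonneg _).trans h

lemma aestronglyMeasurable_lyapunovPoly {X : Type*} [MeasurableSpace X] {μ : Measure X} (n : ℕ)
    (θ σ ρ : ℕ → ℝ) {u v w z : X → ℝ} (hu : AEStronglyMeasurable u μ)
    (hv : AEStronglyMeasurable v μ) (hw : AEStronglyMeasurable w μ)
    (hz : AEStronglyMeasurable z μ) :
    AEStronglyMeasurable (fun x => lyapunovPoly n θ σ ρ (u x) (v x) (w x) (z x)) μ := by
  have hc : Continuous fun y : (ℝ × ℝ) × (ℝ × ℝ) =>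
      lyapunovPoly n θ σ ρ y.1.1 y.1.2 y.2.1 y.2.2 := by
    unfold lyapunovPoly
    refine continuous_finsetSum _ fun p _ => continuous_finsetSum _ fun q _ =>
      continuous_finsetSum _ fun r _ => continuous_const.mul ?_
    exact (((continuous_fst.fst.pow r).mul (continuous_fst.snd.pow (q - r))).mul
      (continuous_snd.fst.pow (p - q))).mul (continuous_snd.snd.pow (n - p))
  have hf : AEStronglyMeasurable (fun x => ((u x, v x), (w x, z x))) μ :=
    (hu.prodMk hv).prodMk (hw.prodMk hz)
  generalize lyapunovPoly n θ σ ρ = H at hc ⊢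
  exact hc.comp_aestronglyMeasurable hf

lemma integrable_lyapunovPoly_of_bounded {X : Type*} [MeasurableSpace X] {μ : Measure X}
    [IsFiniteMeasure μ] {n : ℕ} {θ σ ρ : ℕ → ℝ} (hθ : ∀ i, 0 ≤ θ i) (hσ : ∀ i, 0 ≤ σ i)
    (hρ : ∀ i, 0 ≤ ρ i) {u v w z : X → ℝ} (hu : AEStronglyMeasurable u μ)
    (hv : AEStronglyMeasurable v μ) (hw : AEStronglyMeasurable w μ)
    (hz : AEStronglyMeasurable z μ) {M : ℝ}
    (hM : ∀ᵐ x ∂μ, |u x| ≤ M ∧ |v x| ≤ M ∧ |w x| ≤ M ∧ |z x| ≤ M) :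
    Integrable (fun x => lyapunovPoly n θ σ ρ (u x) (v x) (w x) (z x)) μ :=
  Integrable.of_bound (aestronglyMeasurable_lyapunovPoly n θ σ ρ hu hv hw hz)
    (lyapunovPoly n θ σ ρ 1 1 1 1 * M ^ n)
    (hM.mono fun _ hx => abs_lyapunovPoly_le hθ hσ hρ hx.1 hx.2.1 hx.2.2.1 hx.2.2.2)

lemma exists_ae_abs_le_of_memLp_top {X : Type*} [MeasurableSpace X] {μ : Measure X} {f : X → ℝ}
    (hf : MemLp f ⊤ μ) : ∃ M : ℝ, ∀ᵐ x ∂μ, |f x| ≤ M := by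
  refine ⟨(eLpNormEssSup f μ).toReal, ?_⟩
  have hlt : eLpNormEssSup f μ < ⊤ := by simpa using hf.eLpNorm_lt_top
  filter_upwards [enorm_ae_le_eLpNormEssSup f μ] with x hx
  have := ENNReal.toReal_mono hlt.ne hx
  simpa using this

/-- Passes from the degree `n` of `H_n` to the moments of order `n + 5`; each splitting of a sum by
convexity costs `2 ^ (n + 4)`. -/
lemma pow_add_le_of_nonneg {n : ℕ} {U W : ℝ} (hU : 0 ≤ U) (hW : 0 ≤ W) :
    (1 + (U + W)) ^ n ≤ 2 ^ (n + 4) * (1 + 2 ^ (n + 4) * (U ^ (n + 5) + W ^ (n + 5))) := by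
  have h1 : (1 + (U + W)) ^ n ≤ (1 + (U + W)) ^ (n + 5) :=
    pow_le_pow_right₀ (by linarith) (by omega)
  have h2 : (1 + (U + W)) ^ (n + 5) ≤ 2 ^ (n + 4) * (1 ^ (n + 5) + (U + W) ^ (n + 5)) :=
    add_pow_le zero_le_one (by positivity) (n + 5)
  have h3 : (U + W) ^ (n + 5) ≤ 2 ^ (n + 4) * (U ^ (n + 5) + W ^ (n + 5)) :=
    add_pow_le hU hW (n + 5)
  refine h1.trans (h2.trans ?_)
  rw [one_pow]
  gcongr

/-- The coefficients of `H_n` being positive, the claim amounts to uniform bounds of the moments of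
the solution; these hold without recourse to the admissibility and ratio conditions. -/
theorem theorem1 {N : ℕ} (hN : 1 ≤ N)
    (Ω : Set (EuclideanSpace ℝ (Fin N))) (hΩ_open : IsOpen Ω) (hΩ_bdd : Bornology.IsBounded Ω)
    (P : BrusselatorParams)
    (θ σ ρ : ℝ) (hadm : P.Admissible θ σ ρ)
    (n : ℕ) (hn : 1 ≤ n)
    (θs σs ρs : ℕ → ℝ)
    (hθ : IsRatioSequence n θ θs) (hσ : IsRatioSequence n σ σs) (hρ : IsRatioSequence n ρ ρs)
    (Tmax : EReal) (hT : 0 < Tmax)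
    (u v w z : ℝ → EuclideanSpace ℝ (Fin N) → ℝ)
    (hsol : IsBrusselatorSolution P Ω Tmax u v w z) :
    (∀ t : ℝ, 0 ≤ t → (t : EReal) < Tmax →
      IntegrableOn (fun x => lyapunovPoly n θs σs ρs (u t x) (v t x) (w t x) (z t x)) Ω) ∧
    ∃ C : ℝ, ∀ t : ℝ, 0 ≤ t → (t : EReal) < Tmax →
      |lyapunovFunctional Ω n θs σs ρs u v w z t| ≤ C := by
  have hθ0 : ∀ i, 0 ≤ θs i := fun i => (hθ.pos i).le
  have hσ0 : ∀ i, 0 ≤ σs i := fun i => (hσ.pos i).le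
  have hρ0 : ∀ i, 0 ≤ ρs i := fun i => (hρ.pos i).le
  have hfin : volume Ω < ⊤ := hΩ_bdd.measure_lt_top
  have : IsFiniteMeasure (volume.restrict Ω) := ⟨by simpa using hfin⟩
  constructor
  · intro t ht htT
    rcases ht.eq_or_lt with rfl | ht
    · obtain ⟨M₁, h₁⟩ := exists_ae_abs_le_of_memLp_top hsol.comp_u.initial_memLp
      obtain ⟨M₂, h₂⟩ := exists_ae_abs_le_of_memLp_top hsol.comp_v.initial_memLp
      obtain ⟨M₃, h₃⟩ := exists_ae_abs_le_of_memLp_top hsol.comp_w.initial_memLp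
      obtain ⟨M₄, h₄⟩ := exists_ae_abs_le_of_memLp_top hsol.comp_z.initial_memLp
      refine integrable_lyapunovPoly_of_bounded hθ0 hσ0 hρ0
        hsol.comp_u.initial_memLp.aestronglyMeasurable
        hsol.comp_v.initial_memLp.aestronglyMeasurable
        hsol.comp_w.initial_memLp.aestronglyMeasurable
        hsol.comp_z.initial_memLp.aestronglyMeasurable (M := max (max M₁ M₂) (max M₃ M₄)) ?_
      filter_upwards [h₁, h₂, h₃, h₄] with x k₁ k₂ k₃ k₄
      exact ⟨k₁.trans ((le_max_left _ _).trans (le_max_left _ _)),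
        k₂.trans ((le_max_right _ _).trans (le_max_left _ _)),
        k₃.trans ((le_max_left _ _).trans (le_max_right _ _)),
        k₄.trans ((le_max_right _ _).trans (le_max_right _ _))⟩
    · obtain ⟨M, -, hM⟩ := hsol.exists_abs_le htT
      exact integrable_lyapunovPoly_of_bounded hθ0 hσ0 hρ0
        ((hsol.comp_u.continuousOn_slice ht htT).aestronglyMeasurable hΩ_open.measurableSet)
        ((hsol.comp_v.continuousOn_slice ht htT).aestronglyMeasurable hΩ_open.measurableSet)
        ((hsol.comp_w.continuousOn_slice ht htT).aestronglyMeasurable hΩ_open.measurableSet)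
        ((hsol.comp_z.continuousOn_slice ht htT).aestronglyMeasurable hΩ_open.measurableSet)
        ((ae_restrict_mem hΩ_open.measurableSet).mono fun x hx => hM t ht le_rfl x hx)
  · obtain ⟨t₀, ht₀, ht₀T⟩ := exists_gt_coe_lt (t := 0) (T := Tmax) (by simpa using hT)
    obtain ⟨M, hM0, hM⟩ := hsol.exists_abs_le ht₀T
    obtain ⟨M', hM'0, hM'⟩ := hsol.exists_v_z_le hN hΩ_open hΩ_bdd ht₀ ht₀T
    obtain ⟨C, hC⟩ := hsol.exists_integral_excess_pow_le hN hΩ_open hΩ_bdd n ht₀ ht₀T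
    set H := lyapunovPoly n θs σs ρs 1 1 1 1
    have hH : 0 ≤ H := lyapunovPoly_one_nonneg hθ0 hσ0 hρ0
    set m := volume.real Ω with hm
    set c : ℝ := 2 ^ (n + 4)
    -- One bound for each of `t = 0`, `0 < t ≤ t₀` (local boundedness) and `t ≥ t₀` (moments).
    refine ⟨max |lyapunovFunctional Ω n θs σs ρs u v w z 0|
      (max (H * M ^ n * m) (H * (M' + 1) ^ n * c * (m + c * C))), fun t ht htT => ?_⟩
    rcases ht.eq_or_lt with rfl | ht
    · exact le_max_left _ _
    refine le_trans ?_ (le_max_right _ _)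
    unfold lyapunovFunctional
    rcases le_total t t₀ with htt | htt
    · refine le_trans ?_ (le_max_left _ _)
      have := norm_setIntegral_le_of_norm_le_const (μ := volume) (s := Ω) (C := H * M ^ n)
        (f := fun x => lyapunovPoly n θs σs ρs (u t x) (v t x) (w t x) (z t x)) hfin
        fun x hx => by
          obtain ⟨b₁, b₂, b₃, b₄⟩ := hM t ht htt x hx
          exact abs_lyapunovPoly_le hθ0 hσ0 hρ0 b₁ b₂ b₃ b₄
      simpa using this
    · refine le_trans ?_ (le_max_right _ _)
      obtain ⟨hint, hle⟩ := hC t htt htT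
      have hconst : IntegrableOn (fun _ : EuclideanSpace ℝ (Fin N) => (1 : ℝ)) Ω :=
        integrableOn_const hfin.ne
      have hbound : ∀ x ∈ Ω, |lyapunovPoly n θs σs ρs (u t x) (v t x) (w t x) (z t x)|
          ≤ H * (M' + 1) ^ n * c
            * (1 + c * (excess (u t x) ^ (n + 5) + excess (w t x) ^ (n + 5))) := by
        intro x hx
        obtain ⟨n₁, n₂, n₃, n₄⟩ := hsol.nonneg hΩ_open hΩ_bdd ht htT x hx
        obtain ⟨b₂, b₄⟩ := hM' t htt htT x hx
        have hU := excess_nonneg (u t x)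
        have hW := excess_nonneg (w t x)
        have hu := le_excess_add_one (u t x)
        have hw := le_excess_add_one (w t x)
        set U := excess (u t x)
        set W := excess (w t x)
        have hUW : 0 ≤ U + W := by positivity
        have hMUW : 0 ≤ M' * (U + W) := by positivity
        -- A common bound of all four components: the expansion dominates `M'` as well as `U + 1`
        -- and `W + 1`.
        have hs : (M' + 1) * (1 + (U + W)) = M' + 1 + (U + W) + M' * (U + W) := by ring
        have h1 := abs_lyapunovPoly_le (n := n) hθ0 hσ0 hρ0 (u := u t x) (v := v t x) (w := w t x)
          (z := z t x) (s := (M' + 1) * (1 + (U + W)))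
          (by rw [abs_of_nonneg n₁]; linarith) (by rw [abs_of_nonneg n₂]; linarith)
          (by rw [abs_of_nonneg n₃]; linarith) (by rw [abs_of_nonneg n₄]; linarith)
        rw [mul_pow, ← mul_assoc] at h1
        refine h1.trans ?_
        rw [mul_assoc (H * (M' + 1) ^ n)]
        exact mul_le_mul_of_nonneg_left (pow_add_le_of_nonneg hU hW) (by positivity)
      have hint' : IntegrableOn (fun x => H * (M' + 1) ^ n * c
          * (1 + c * (excess (u t x) ^ (n + 5) + excess (w t x) ^ (n + 5)))) Ω := (hconst.add (hint.const_mul c)).const_mul (H * (M' + 1) ^ n * c)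
      have h1 := norm_integral_le_of_norm_le (μ := volume.restrict Ω)
        (f := fun x => lyapunovPoly n θs σs ρs (u t x) (v t x) (w t x) (z t x)) hint'
        ((ae_restrict_mem hΩ_open.measurableSet).mono hbound)
      refine h1.trans ?_
      have h2 := integral_add hconst (hint.const_mul c)
      rw [integral_const_mul, h2, integral_const_mul, setIntegral_const, smul_eq_mul, mul_one,
        ← hm]
      gcongr
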